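/- Let $\Gamma$ be a countable amenable group (amenable in the sense of Følner) which is residually finite and contains a non-torsion element with infinite conjugacy class. Then $\Gamma$ has property ID. Here the following terminology is used. For finite sets $F,S\subseteq\Gamma$ and $\delta>0$, the set $S$ is $(F,\delta)$-invariant if $|S\cap\bigcap_{t\in F}t^{-1}S|\ge(1-\delta)|S|$. A tiling of $\Gamma$ is a finite collection $\mathcal T$ of pairs $(S,C)$, where the shapes $S$ are nonempty finite subsets of $\Gamma$ and the center sets $C$ are pairwise disjoint subsets of $\Gamma$, such that $\Gamma=\bigsqcup_{(S,C)\in\mathcal T}\bigsqcup_{c\in C}Sc$; the sets $Sc$ are the tiles, and $c$ is a tiling center for $S$. A sequence $(\mathcal T_n)$ of tilings is - tightly nested if for every $n>1$ and $(S,C)\in\mathcal T_n$ there is a partition $S=\bigsqcup_{j\in J}S_jg_j$ with shapes $S_j$ of $\mathcal T_{n-1}$ and $g_j\in\Gamma$, such that $g_jc$ is a tiling center for $S_j$ in $\mathcal T_{n-1}$ for all $c\in C$ and $j\in J$; - a sequence of Følner tilings if for every finite $F\subseteq\Gamma$ and every $\delta>0$ there is an $N$ such that for all $n\ge N$ every shape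 of $\mathcal T_n$ is $(F,\delta)$-invariant. The entropy of a tiling $\mathcal T$ with set of shapes $\mathcal S$ is the topological entropy of the right shift action $(sx)_t=x_{ts}$ of $\Gamma$ on the closed set $\overline{\Gamma x}\subseteq(\mathcal S\sqcup\{0\})^\Gamma$, where $x_t=S$ if $t$ is a tiling center for $S$ and $x_t=0$ if $t$ is not a tiling center. The topological entropy of an action on a compact space is $\sup_{\mathcal U}\lim_n\frac1{|F_n|}\log N(\bigvee_{s\in F_n}s^{-1}\mathcal U)$, where $(F_n)$ is a (left) Følner sequence, $\mathcal U$ ranges over the finite open covers and $N(\cdot)$ is the minimal cardinality of a subcover (it does not depend on $(F_n)$). A set $C\subseteq\Gamma$ is syndetic if $FC=\Gamma$ for some finite $F\subseteq\Gamma$. The group $\Gamma$ has property ID if there are an infinite cyclic subgroup $H\subseteq\Gamma$ of infinite index and a tightly nested sequence $(\mathcal T_n)$ of Følner tilings with syndetic center sets and entropies converging to zero such that 1. every finite subset of $\Gamma$ is contained in some tile of some $\mathcal T_n$; 2. for every $\delta>0$ there is an $n_0$ such that $|H\cap T|\le\delta|T|$ for all $n\ge n_0$ and every tile $T$ of $\mathcal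 T_n$; 3. for every $n$ there are a shape $S$ of $\mathcal T_n$ and a subgroup $H_0$ of $H$ such that every $c\in H_0$ is a tiling center for $S$ in $\mathcal T_n$ and $H\subseteq\bigcup_{c\in H_0}Sc$. -/

import Mathlib

open Filter Topology

noncomputable section

namespace PropID

/-! ### Invariance, amenability and Følner sequences -/

section Invariance

variable {Γ : Type*} [Group Γ]

/-- `S` is `(F, δ)`-invariant: `|S ∩ ⋂_{t ∈ F} t⁻¹ S| ≥ (1 - δ) |S|`. -/
def IsInvariant (F : Finset Γ) (δ : ℝ) (S : Finset Γ) : Prop :=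
  (1 - δ) * (S.card : ℝ) ≤ (((S : Set Γ) ∩ ⋂ t ∈ F, {s : Γ | t * s ∈ S}).ncard : ℝ)

/-- `(F n)` is a (left) Følner sequence of nonempty finite sets. -/
def IsFolnerSeq (F : ℕ → Finset Γ) : Prop :=
  (∀ n, (F n).Nonempty) ∧
    ∀ (K : Finset Γ) (δ : ℝ), 0 < δ → ∃ N, ∀ n ≥ N, IsInvariant K δ (F n)

variable (Γ) in
/-- Amenability of a discrete group, in the form of the Følner condition. -/
def IsAmenable : Prop :=
  ∀ (K : Finset Γ) (δ : ℝ), 0 < δ → ∃ S : Finset Γ, S.Nonempty ∧ IsInvariant K δ S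

/-- `C` is syndetic: `F C = Γ` for some finite set `F`. -/
def IsSyndetic (C : Set Γ) : Prop :=
  ∃ F : Finset Γ, ∀ g : Γ, ∃ f ∈ F, ∃ c ∈ C, f * c = g

/-- The right translate `S c` of a finite set. -/
def rightTranslate (S : Finset Γ) (c : Γ) : Finset Γ :=
  S.map (mulRightEmbedding c)

end Invariance

/-! ### Topological entropy -/

section Entropy

variable {X : Type*}

/-- The minimal cardinality of a (finite) subcover of `𝒰`. -/
def coverNumber (𝒰 : Set (Set X)) : ℕ :=
  sInf {n | ∃ 𝒱 : Finset (Set X), (𝒱 : Set (Set X)) ⊆ 𝒰 ∧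
    ⋃₀ (𝒱 : Set (Set X)) = Set.univ ∧ 𝒱.card = n}

/-- The join `𝒰^F = ⋁_{s ∈ F} s⁻¹ 𝒰`. -/
def joinCover {Γ : Type*} [SMul Γ X] (F : Finset Γ) (𝒰 : Set (Set X)) : Set (Set X) :=
  {W | ∃ U : Γ → Set X, (∀ s ∈ F, U s ∈ 𝒰) ∧ W = ⋂ s ∈ F, {x : X | s • x ∈ U s}}

/-- `𝒰` is a finite open cover of `X`. -/
def IsFiniteOpenCover [TopologicalSpace X] (𝒰 : Set (Set X)) : Prop :=
  𝒰.Finite ∧ (∀ U ∈ 𝒰, IsOpen U) ∧ ⋃₀ 𝒰 = Set.univ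

/-- The topological entropy of an action `Γ ↷ X`, computed along the sequence `F` of finite sets:
`sup_𝒰 limsup_n |F_n|⁻¹ log N(𝒰^{F_n})`. For a Følner sequence of an amenable group acting
continuously on a compact space the upper limit is a limit, and does not depend on `F`. -/
def topEntropy {Γ : Type*} [Group Γ] (F : ℕ → Finset Γ) (X : Type*) [TopologicalSpace X]
    [MulAction Γ X] : EReal :=
  ⨆ (𝒰 : Set (Set X)) (_ : IsFiniteOpenCover 𝒰),
    limsup (fun n => ((Real.log (coverNumber (joinCover (F n) 𝒰)) / (F n).card : ℝ) : EReal)) atTop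

end Entropy

/-! ### The right shift -/

section Shift

/-- The space `A^Γ`, with the product of the discrete topologies and the right shift action
`(s x)_t = x_{t s}`. -/
def Shift (Γ A : Type*) : Type _ := Γ → A

variable {Γ A : Type*} [Group Γ]

instance : TopologicalSpace (Shift Γ A) :=
  @Pi.topologicalSpace Γ (fun _ => A) (fun _ => ⊥)

instance : MulAction Γ (Shift Γ A) where
  smul s x := fun t => x (t * s)
  one_smul x := funext fun t => congrArg x (mul_one t)
  mul_smul s r x := funext fun t => congrArg x (mul_assoc t s r).symm

theorem Shift.smul_apply (s : Γ) (x : Shift Γ A) (t : Γ) : (s • x) t = x (t * s) := rfl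

theorem Shift.continuous_smul (s : Γ) : Continuous fun x : Shift Γ A => s • x :=
  @continuous_pi _ _ _ _ (fun _ => ⊥) _ fun t =>
    @continuous_apply Γ (fun _ => A) (fun _ => ⊥) (t * s)

/-- The closure of the orbit `Γ x`, as a closed `Γ`-invariant set. -/
def orbitClosure (x : Shift Γ A) : SubMulAction Γ (Shift Γ A) where
  carrier := closure (MulAction.orbit Γ x)
  smul_mem' s _ hy :=
    map_mem_closure (Shift.continuous_smul s) hy fun _ hz =>
      MulAction.mem_orbit_of_mem_orbit s hz

end Shift

/-! ### Tilings -/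

section Tilings

variable {Γ : Type*} [Group Γ]

variable (Γ) in
/-- A tiling of `Γ`: a finite collection of pairs `(S, C)` of a nonempty finite shape and a set of
centers such that `Γ` is the disjoint union of the tiles `S c`, over all pairs and all `c ∈ C`.
Different pairs have disjoint center sets, so that a center determines the shape of its tile. -/
structure Tiling where
  pairs : Finset (Finset Γ × Set Γ)
  shape_nonempty : ∀ p ∈ pairs, p.1.Nonempty
  existsUnique_tile : ∀ g : Γ, ∃! q : (Finset Γ × Set Γ) × Γ,
    q.1 ∈ pairs ∧ q.2 ∈ q.1.2 ∧ g ∈ rightTranslate q.1.1 q.2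
  centers_disjoint : ∀ p ∈ pairs, ∀ q ∈ pairs, p ≠ q → Disjoint p.2 q.2

namespace Tiling

/-- `S` is a shape of the tiling. -/
def IsShape (𝒯 : Tiling Γ) (S : Finset Γ) : Prop :=
  ∃ C : Set Γ, (S, C) ∈ 𝒯.pairs

/-- `c` is a tiling center for the shape `S`. -/
def IsCenter (𝒯 : Tiling Γ) (S : Finset Γ) (c : Γ) : Prop :=
  ∃ C : Set Γ, (S, C) ∈ 𝒯.pairs ∧ c ∈ C

/-- `T` is a tile of the tiling. -/
def IsTile (𝒯 : Tiling Γ) (T : Finset Γ) : Prop :=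
  ∃ S c, 𝒯.IsCenter S c ∧ T = rightTranslate S c

theorem IsCenter.isShape {𝒯 : Tiling Γ} {S : Finset Γ} {c : Γ} (h : 𝒯.IsCenter S c) :
    𝒯.IsShape S :=
  let ⟨C, hC, _⟩ := h
  ⟨C, hC⟩

/-- The finite alphabet consisting of the shapes and of an extra symbol `0`, here `none`. -/
abbrev Symbols (𝒯 : Tiling Γ) : Type _ := Option {S : Finset Γ // 𝒯.IsShape S}

open Classical in
/-- The point of the shift coding the tiling: `x_t = S` if `t` is a center for the shape `S`, and
`x_t = 0` if `t` is not a center. -/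
def coding (𝒯 : Tiling Γ) : Shift Γ 𝒯.Symbols := fun t =>
  if h : ∃ S, 𝒯.IsCenter S t then some ⟨h.choose, h.choose_spec.isShape⟩ else none

theorem coding_eq_some {𝒯 : Tiling Γ} {S : Finset Γ} {t : Γ} (h : 𝒯.IsCenter S t) :
    𝒯.coding t = some ⟨S, h.isShape⟩ := by
  have hex : ∃ S, 𝒯.IsCenter S t := ⟨S, h⟩
  have heq : hex.choose = S := by
    obtain ⟨C, hC, htC⟩ := h
    obtain ⟨C', hC', htC'⟩ := hex.choose_spec
    by_contra hne
    refine Set.disjoint_left.1 (𝒯.centers_disjoint _ hC' _ hC ?_) htC' htC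
    exact fun he => hne (congrArg Prod.fst he)
  unfold coding
  rw [dif_pos hex]
  exact congrArg some (Subtype.ext heq)

/-- The entropy of a tiling: the topological entropy of the right shift action on the orbit closure
of its coding. -/
def entropy (F : ℕ → Finset Γ) (𝒯 : Tiling Γ) : EReal :=
  topEntropy F (orbitClosure 𝒯.coding)

end Tiling

/-- For every `n` and every `(S, C) ∈ 𝒯 (n + 1)`, the shape `S` is a disjoint union
`⨆_j S_j g_j` of translates of shapes of `𝒯 n` such that `g_j c` is a center for `S_j` in `𝒯 n`
for all `c ∈ C` and all `j`; here `D` is the set of all pairs `(S_j, g_j)`. -/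
def IsTightlyNested (𝒯 : ℕ → Tiling Γ) : Prop :=
  ∀ n, ∀ p ∈ (𝒯 (n + 1)).pairs, ∃ D : Finset (Finset Γ × Γ),
    (∀ q ∈ D, (𝒯 n).IsShape q.1) ∧
    (∀ q ∈ D, rightTranslate q.1 q.2 ⊆ p.1) ∧
    (∀ s ∈ p.1, ∃! q, q ∈ D ∧ s ∈ rightTranslate q.1 q.2) ∧
    ∀ c ∈ p.2, ∀ q ∈ D, (𝒯 n).IsCenter q.1 (q.2 * c)

/-- A sequence of Følner tilings. -/
def IsFolnerTilingSeq (𝒯 : ℕ → Tiling Γ) : Prop :=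
  ∀ (F : Finset Γ) (δ : ℝ), 0 < δ → ∃ N, ∀ n ≥ N, ∀ S, (𝒯 n).IsShape S → IsInvariant F δ S

/-- `H` and `𝒯` are as required in the definition of property ID. -/
structure RealizesPropertyID (H : Subgroup Γ) (𝒯 : ℕ → Tiling Γ) : Prop where
  isCyclic : IsCyclic H
  infinite : Infinite H
  infinite_index : ¬ H.FiniteIndex
  tightlyNested : IsTightlyNested 𝒯
  folner : IsFolnerTilingSeq 𝒯
  syndetic : ∀ n, ∀ p ∈ (𝒯 n).pairs, IsSyndetic p.2
  entropy_tendsto : ∀ F : ℕ → Finset Γ, IsFolnerSeq F →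
    Tendsto (fun n => (𝒯 n).entropy F) atTop (𝓝 0)
  finset_subset_tile : ∀ F : Finset Γ, ∃ n T, (𝒯 n).IsTile T ∧ F ⊆ T
  thin : ∀ δ : ℝ, 0 < δ → ∃ n₀, ∀ n ≥ n₀, ∀ T, (𝒯 n).IsTile T →
    (((H : Set Γ) ∩ T).ncard : ℝ) ≤ δ * T.card
  covers : ∀ n, ∃ S : Finset Γ, ∃ H₀ : Subgroup Γ, H₀ ≤ H ∧ (𝒯 n).IsShape S ∧
    (∀ c ∈ H₀, (𝒯 n).IsCenter S c) ∧ ∀ h ∈ H, ∃ c ∈ H₀, h ∈ rightTranslate S c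

variable (Γ) in
/-- Property ID. -/
def HasPropertyID : Prop :=
  ∃ (H : Subgroup Γ) (𝒯 : ℕ → Tiling Γ), RealizesPropertyID H 𝒯

end Tilings

end PropID

end

/-! Let `H` be generated by the given element `a`. The tilings come from a decreasing sequence of
finite index normal subgroups `N` with Følner transversals `F`, and all centers of a level lie in
`N`. A pattern of the coding is then supported in a single coset of `N`, so the entropy is at most
`2 log 3 / |F|` (`topEntropy_orbitClosure_le`).

Translates of `F` by `H ∩ N` need not cover `H`. Hence a second, special shape `F Z`, with `Z ⊆ N`
finite and `H ⊆ F Z (H ∩ N)`. As `Z` is injective modulo `H`, the tiles `F Z l` with `l ∈ H ∩ N` are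
disjoint.

The next transversal is `F D`, where `D` is a transversal of the next subgroup `Δ` in `N`, and the
next special shape is `F D Z'`. The latter is cut into tiles `F Z j`, with `j` in a transversal `J`
of `H ∩ Δ` in `H ∩ N`, and regular tiles `F y`; the former into one tile `F Z c` and regular tiles.
This needs `Z J ⊆ D Z'` and `Z c ⊆ D`. The set `D Z'` is also made to absorb prescribed finite sets,
so the special shapes exhaust `Γ`, and cutting them up repeatedly yields the tilings.

The crux is `exists_refines`: `D` must be almost invariant although some of its elements are
prescribed. An averaging argument gives an almost equivariant section of `N / Δ` (`exists_section`),
whose values are then changed over the few classes of a finite set `X`. The set `Z'` consists of the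
remainders of `X` modulo `D`; they are distinct modulo `H` for generic representatives, since `H`
has infinite index (`exists_generic_section`). The number of changes is a multiple of the order of
the image of `H` in `Γ / Δ`. This is negligible because many distinct conjugates of `a` force that
image to have large index (`card_mul_card_map_zpowers_le`). The same estimate makes `H` thin in the
tiles. -/

open scoped Pointwise

namespace PropID

/-! ### Almost invariant sets -/

section Invariance

variable {Γ : Type*} [Group Γ] [DecidableEq Γ]

/-- Invariance, in terms of the set of points that some element of `F` moves out of `S`. -/
theorem isInvariant_iff (F : Finset Γ) (δ : ℝ) (S : Finset Γ) :
    IsInvariant F δ S ↔ ((S.filter fun s => ∃ t ∈ F, t * s ∉ S).card : ℝ) ≤ δ * S.card := by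
  have h : ((S : Set Γ) ∩ ⋂ t ∈ F, {s : Γ | t * s ∈ S}) =
      ((S.filter fun s => ¬ ∃ t ∈ F, t * s ∉ S : Finset Γ) : Set Γ) := by
    ext s
    simp
  have hc := Finset.card_filter_add_card_filter_not (s := S) (fun s => ∃ t ∈ F, t * s ∉ S)
  unfold IsInvariant
  rw [h, Set.ncard_coe_finset, ← hc]
  push_cast
  constructor <;> intro h' <;> linarith

theorem IsInvariant.mono {E F : Finset Γ} {δ ε : ℝ} {S : Finset Γ} (h : IsInvariant F δ S)
    (hEF : E ⊆ F) (hδ : δ ≤ ε) : IsInvariant E ε S := by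
  rw [isInvariant_iff] at h ⊢
  have h1 : (S.filter fun s => ∃ t ∈ E, t * s ∉ S).card ≤
      (S.filter fun s => ∃ t ∈ F, t * s ∉ S).card :=
    Finset.card_le_card fun s hs => by
      simp only [Finset.mem_filter] at hs ⊢
      exact ⟨hs.1, hs.2.imp fun t ht => ⟨hEF ht.1, ht.2⟩⟩
  calc ((S.filter fun s => ∃ t ∈ E, t * s ∉ S).card : ℝ)
      ≤ (S.filter fun s => ∃ t ∈ F, t * s ∉ S).card := by exact_mod_cast h1
    _ ≤ δ * S.card := h
    _ ≤ ε * S.card := by gcongr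

theorem IsInvariant.card_mul_le {K S : Finset Γ} {δ : ℝ} (h : IsInvariant K δ S) :
    ((K * S).card : ℝ) ≤ (1 + K.card * δ) * S.card := by
  rw [isInvariant_iff] at h
  have h1 : K * S ⊆ S ∪ K * (S.filter fun s => ∃ t ∈ K, t * s ∉ S) := by
    intro g hg
    obtain ⟨t, ht, s, hs, rfl⟩ := Finset.mem_mul.1 hg
    by_cases hts : t * s ∈ S
    · exact Finset.mem_union_left _ hts
    · exact Finset.mem_union_right _
        (Finset.mul_mem_mul ht (Finset.mem_filter.2 ⟨hs, t, ht, hts⟩))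
  have h2 : (K * S).card ≤ S.card + K.card * (S.filter fun s => ∃ t ∈ K, t * s ∉ S).card :=
    (Finset.card_le_card h1).trans <| (Finset.card_union_le _ _).trans <|
      Nat.add_le_add_left Finset.card_mul_le _
  calc ((K * S).card : ℝ)
      ≤ S.card + K.card * (S.filter fun s => ∃ t ∈ K, t * s ∉ S).card := by exact_mod_cast h2
    _ ≤ S.card + K.card * (δ * S.card) := by gcongr
    _ = _ := by ring

theorem IsInvariant.card_le {K S : Finset Γ} {δ : ℝ} (h : IsInvariant K δ S) (hS : S.Nonempty)
    (hδ : δ < 1) : K.card ≤ S.card := by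
  rw [isInvariant_iff] at h
  have hlt : (S.filter fun s => ∃ t ∈ K, t * s ∉ S).card < S.card := by
    have : (0 : ℝ) < S.card := by exact_mod_cast hS.card_pos
    have : ((S.filter fun s => ∃ t ∈ K, t * s ∉ S).card : ℝ) < S.card := by nlinarith
    exact_mod_cast this
  obtain ⟨s, hs, hs'⟩ := Finset.exists_mem_notMem_of_card_lt_card hlt
  have hK : ∀ t ∈ K, t * s ∈ S := by
    intro t ht
    by_contra hts
    exact hs' (Finset.mem_filter.2 ⟨hs, t, ht, hts⟩)
  exact Finset.card_le_card_of_injOn (fun t => t * s) hK fun _ _ _ _ h => mul_right_cancel h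

theorem IsFolnerSeq.tendsto_card [Infinite Γ] {F : ℕ → Finset Γ} (hF : IsFolnerSeq F) :
    Tendsto (fun n => (F n).card) atTop atTop := by
  refine tendsto_atTop.2 fun b => ?_
  obtain ⟨K, hK⟩ := Infinite.exists_subset_card_eq Γ b
  obtain ⟨N, hN⟩ := hF.2 K (1 / 2) (by norm_num)
  filter_upwards [eventually_ge_atTop N] with n hn
  rw [← hK]
  exact (hN n hn).card_le (hF.1 n) (by norm_num)

end Invariance

/-! ### Entropy of configurations supported in a finite index subgroup -/

section Entropy

variable {Γ A : Type*}

theorem compactSpace_shift [Finite A] : CompactSpace (Shift Γ A) :=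
  @Pi.compactSpace Γ (fun _ => A) (fun _ => ⊥) fun _ => @Finite.compactSpace A ⊥ _

theorem exists_cylinder_subset {V : Set (Shift Γ A)} (hV : IsOpen V) {y : Shift Γ A} (hy : y ∈ V) :
    ∃ E : Finset Γ, ∀ z : Shift Γ A, (∀ e ∈ E, z e = y e) → z ∈ V := by
  let _ : TopologicalSpace A := ⊥
  obtain ⟨E, u, hu, hsub⟩ := (isOpen_pi_iff (A := fun _ : Γ => A)).1 hV y hy
  refine ⟨E, fun z hz => hsub fun e he => ?_⟩
  rw [hz e he]
  exact (hu e he).2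

theorem isOpen_cylinder (E : Finset Γ) (y : Shift Γ A) :
    IsOpen {z : Shift Γ A | ∀ e ∈ E, z e = y e} := by
  let _ : TopologicalSpace A := ⊥
  have : DiscreteTopology A := ⟨rfl⟩
  have h : {z : Shift Γ A | ∀ e ∈ E, z e = y e} = (E : Set Γ).pi fun e => ({y e} : Set A) := by
    ext z
    rfl
  rw [h]
  exact isOpen_set_pi (A := fun _ : Γ => A) E.finite_toSet fun e _ => isOpen_discrete _

/-- Every finite open cover of a closed set of configurations is refined by the cylinders over some
finite window. -/
theorem exists_window [Finite A] {X : Set (Shift Γ A)} (hX : IsClosed X) {𝒰 : Set (Set X)}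
    (h𝒰 : IsFiniteOpenCover 𝒰) :
    ∃ E : Finset Γ, ∀ y : X, ∃ U ∈ 𝒰, ∀ z : X, (∀ e ∈ E, z.1 e = y.1 e) → z ∈ U := by
  classical
  have := compactSpace_shift (Γ := Γ) (A := A)
  have : CompactSpace X := isCompact_iff_compactSpace.1 hX.isCompact
  have h1 : ∀ y : X, ∃ E : Finset Γ, ∃ U ∈ 𝒰, ∀ z : X, (∀ e ∈ E, z.1 e = y.1 e) → z ∈ U := by
    intro y
    obtain ⟨U, hU, hyU⟩ : y ∈ ⋃₀ 𝒰 := h𝒰.2.2 ▸ Set.mem_univ y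
    obtain ⟨V, hV, rfl⟩ := isOpen_induced_iff.1 (h𝒰.2.1 U hU)
    obtain ⟨E, hE⟩ := exists_cylinder_subset hV hyU
    exact ⟨E, _, hU, fun z hz => hE z.1 hz⟩
  choose E U hU hEU using h1
  obtain ⟨t, -, ht⟩ := (isCompact_univ (X := X)).elim_nhds_subcover
    (fun y => {z : X | ∀ e ∈ E y, z.1 e = y.1 e})
    fun y _ => ((isOpen_cylinder (E y) y.1).preimage continuous_subtype_val).mem_nhds
      fun _ _ => rfl
  refine ⟨t.biUnion E, fun y => ?_⟩
  obtain ⟨w, hw, hyw⟩ := Set.mem_iUnion₂.1 (ht (Set.mem_univ y))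
  refine ⟨U w, hU w, fun z hz => hEU w z fun e he => ?_⟩
  rw [hz e (Finset.mem_biUnion.2 ⟨w, hw, he⟩)]
  exact hyw e he

theorem coverNumber_le {X ι : Type*} [Finite ι] {𝒰 : Set (Set X)} (V : ι → Set X)
    (hV : ∀ i, V i ∈ 𝒰) (hcov : ∀ x, ∃ i, x ∈ V i) : coverNumber 𝒰 ≤ Nat.card ι := by
  classical
  have := Fintype.ofFinite ι
  have hle : coverNumber 𝒰 ≤ (Finset.univ.image V).card := by
    refine Nat.sInf_le ⟨Finset.univ.image V, ?_, ?_, rfl⟩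
    · intro W hW
      obtain ⟨i, -, rfl⟩ := Finset.mem_image.1 (Finset.mem_coe.1 hW)
      exact hV i
    · refine Set.eq_univ_of_forall fun x => ?_
      obtain ⟨i, hi⟩ := hcov x
      exact ⟨V i, Finset.mem_coe.2 (Finset.mem_image_of_mem _ (Finset.mem_univ i)), hi⟩
  refine hle.trans ?_
  rw [Nat.card_eq_fintype_card]
  exact Finset.card_image_le

variable [Group Γ]

/-- If the symbols other than `o` of a configuration `x` sit in a finite index normal subgroup `N`,
then the orbit closure has few patterns over the windows `E * F`. -/
theorem coverNumber_orbitClosure_le [DecidableEq Γ] [Finite A] (x : Shift Γ A) (o : A)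
    (N : Subgroup Γ) [N.Normal] [N.FiniteIndex] [DecidableEq (Γ ⧸ N)]
    (hx : ∀ t, x t ≠ o → t ∈ N) {𝒰 : Set (Set (orbitClosure x))} {E : Finset Γ}
    (hE : ∀ y : orbitClosure x, ∃ U ∈ 𝒰, ∀ z : orbitClosure x,
      (∀ e ∈ E, z.1 e = y.1 e) → z ∈ U) (F : Finset Γ) (m : ℕ)
    (hm : ∀ u : Γ ⧸ N, ((E * F).filter fun t : Γ => (t : Γ ⧸ N) = u).card ≤ m) :
    coverNumber (joinCover F 𝒰) ≤ N.index * Nat.card A ^ m := by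
  classical
  have := Fintype.ofFinite A
  have := Fintype.ofFinite (Γ ⧸ N)
  let W : Γ ⧸ N → Finset Γ := fun u => (E * F).filter fun t : Γ => (t : Γ ⧸ N) = u
  let ext : (Σ u : Γ ⧸ N, (W u → A)) → Γ → A := fun τ t =>
    if h : t ∈ W τ.1 then τ.2 ⟨t, h⟩ else o
  have : Nonempty A := ⟨o⟩
  have hpat : ∀ y : orbitClosure x, ∃ τ, ∀ t ∈ E * F, y.1 t = ext τ t := by
    intro y
    obtain ⟨_, hz, g, rfl⟩ := mem_closure_iff.1 y.2 _ (isOpen_cylinder (E * F) y.1)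
      fun _ _ => rfl
    -- A symbol `x (t * g) ≠ o` forces `t * g ∈ N`, which by normality puts `t` in the coset of
    -- `g⁻¹`. Off that coset the pattern is constantly `o`.
    refine ⟨⟨((g⁻¹ : Γ) : Γ ⧸ N), fun t => x (t * g)⟩, fun t ht => ?_⟩
    rw [← hz t ht]
    change x (t * g) = _
    by_cases hmem : t ∈ W ((g⁻¹ : Γ) : Γ ⧸ N)
    · simp only [ext, dif_pos hmem]
    · simp only [ext, dif_neg hmem]
      by_contra hne
      refine hmem (Finset.mem_filter.2 ⟨ht, ?_⟩)
      have h1 := hx _ hne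
      refine QuotientGroup.eq.2 ?_
      have h2 := N.inv_mem h1
      rw [mul_inv_rev] at h2
      exact (Subgroup.Normal.mem_comm_iff inferInstance).1 h2
  have hone : x ∈ orbitClosure x := subset_closure (MulAction.mem_orbit_self x)
  have hjoin : ∀ y : orbitClosure x, ∃ V ∈ joinCover F 𝒰, ∀ z : orbitClosure x,
      (∀ t ∈ E * F, z.1 t = y.1 t) → z ∈ V := by
    intro y
    choose U hU hUE using fun s : Γ => hE (s • y)
    refine ⟨_, ⟨U, fun s _ => hU s, rfl⟩, fun z hz => Set.mem_iInter₂.2 fun s hs => ?_⟩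
    exact hUE s (s • z) fun e he => hz (e * s) (Finset.mul_mem_mul he hs)
  have hV : ∀ τ, ∃ V ∈ joinCover F 𝒰, ∀ z : orbitClosure x,
      (∀ t ∈ E * F, z.1 t = ext τ t) → z ∈ V := by
    intro τ
    -- A pattern that does not occur imposes no condition, so any member of the join serves.
    by_cases hτ : ∃ y : orbitClosure x, ∀ t ∈ E * F, y.1 t = ext τ t
    · obtain ⟨y, hy⟩ := hτ
      obtain ⟨V, hV, hyV⟩ := hjoin y
      exact ⟨V, hV, fun z hz => hyV z fun t ht => (hz t ht).trans (hy t ht).symm⟩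
    · obtain ⟨V, hV, -⟩ := hjoin ⟨x, hone⟩
      exact ⟨V, hV, fun z hz => (hτ ⟨z, hz⟩).elim⟩
  choose V hVm hVc using hV
  refine (coverNumber_le V hVm fun y => ?_).trans ?_
  · obtain ⟨τ, hτ⟩ := hpat y
    exact ⟨τ, hVc τ y hτ⟩
  · rw [Nat.card_sigma]
    calc ∑ u : Γ ⧸ N, Nat.card (W u → A) ≤ ∑ _u : Γ ⧸ N, Nat.card A ^ m := by
          refine Finset.sum_le_sum fun u _ => ?_
          rw [Nat.card_fun, Nat.card_eq_fintype_card (α := W u), Fintype.card_coe]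
          exact Nat.pow_le_pow_right Nat.card_pos (hm u)
      _ = N.index * Nat.card A ^ m := by
          rw [Finset.sum_const, Finset.card_univ, smul_eq_mul, Subgroup.index_eq_card,
            ← Nat.card_eq_fintype_card (α := Γ ⧸ N)]

/-- Multiplying the part of `E * F n` in one coset of `N` by the elements of `T` produces no
coincidences inside `T * E * F n`, a set of size at most `2 |F n|` for late `n`. So one coset
carries at most `2 |F n| / |T|` free symbols, and `log N.index / |F n|` vanishes in the limit. -/
theorem topEntropy_orbitClosure_le [Infinite Γ] [Finite A] (x : Shift Γ A) (o : A)
    (N : Subgroup Γ) [N.Normal] [N.FiniteIndex] (hx : ∀ t, x t ≠ o → t ∈ N)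
    {T : Finset Γ} (hT : T.Nonempty) (hTN : ∀ f ∈ T, ∀ f' ∈ T, f⁻¹ * f' ∈ N → f = f')
    {F : ℕ → Finset Γ} (hF : IsFolnerSeq F) :
    topEntropy F (orbitClosure x) ≤ ((2 * Real.log (Nat.card A) / T.card : ℝ) : EReal) := by
  classical
  have : Nonempty A := ⟨o⟩
  refine iSup₂_le fun 𝒰 h𝒰 => ?_
  obtain ⟨E, hE⟩ := exists_window (X := (orbitClosure x : Set (Shift Γ A))) isClosed_closure h𝒰
  have hTpos : (0 : ℝ) < T.card := by exact_mod_cast hT.card_pos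
  have hk : (1 : ℝ) ≤ Nat.card A := by exact_mod_cast Nat.card_pos (α := A)
  have hindex : (1 : ℝ) ≤ N.index := by
    exact_mod_cast Nat.one_le_iff_ne_zero.2 Subgroup.FiniteIndex.index_ne_zero
  -- This tolerance brings the factor in `IsInvariant.card_mul_le` down to at most 2.
  obtain ⟨n₀, hn₀⟩ := hF.2 (T * E) (1 / ((T * E).card + 1)) (by positivity)
  have hmain : ∀ n ≥ n₀, Real.log (coverNumber (joinCover (F n) 𝒰)) / (F n).card ≤
      Real.log N.index / (F n).card + 2 * Real.log (Nat.card A) / T.card := by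
    intro n hn
    have hFpos : (0 : ℝ) < (F n).card := by exact_mod_cast (hF.1 n).card_pos
    have hcard : (((T * E) * F n).card : ℝ) ≤ 2 * (F n).card := by
      refine (hn₀ n hn).card_mul_le.trans ?_
      gcongr
      rw [mul_one_div]
      have : ((T * E).card : ℝ) / ((T * E).card + 1) ≤ 1 := by
        rw [div_le_one (by positivity)]
        linarith
      linarith
    have := Fintype.ofFinite (Γ ⧸ N)
    obtain ⟨u₀, -, hu₀⟩ := Finset.exists_max_image (Finset.univ : Finset (Γ ⧸ N))
        (fun u => ((E * F n).filter fun t : Γ => (t : Γ ⧸ N) = u).card) ⟨1, Finset.mem_univ _⟩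
    set m := ((E * F n).filter fun t : Γ => (t : Γ ⧸ N) = u₀).card with hm
    have hcov := coverNumber_orbitClosure_le x o N hx hE (F n) m fun u => hu₀ u (Finset.mem_univ u)
    have hTm : T.card * m ≤ ((T * E) * F n).card := by
      rw [hm, ← Finset.card_product]
      refine Finset.card_le_card_of_injOn (fun p => p.1 * p.2) ?_ ?_
      · intro p hp
        obtain ⟨h1, h2⟩ := Finset.mem_product.1 (Finset.mem_coe.1 hp)
        rw [mul_assoc]
        exact Finset.mem_coe.2 (Finset.mul_mem_mul h1 (Finset.mem_filter.1 h2).1)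
      · rintro ⟨f, t⟩ hp ⟨f', t'⟩ hp' heq
        obtain ⟨h1, h2⟩ := Finset.mem_product.1 (Finset.mem_coe.1 hp)
        obtain ⟨h1', h2'⟩ := Finset.mem_product.1 (Finset.mem_coe.1 hp')
        simp only [Finset.mem_filter] at h1 h2 h1' h2'
        change f * t = f' * t' at heq
        have htt : t' * t⁻¹ ∈ N := by
          have := QuotientGroup.eq.1 (h2.2.trans h2'.2.symm)
          exact (Subgroup.Normal.mem_comm_iff inferInstance).1 this
        have hff : f = f' := by
          refine hTN f h1 f' h1' ?_
          have : f⁻¹ * f' = (t' * t⁻¹)⁻¹ := by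
            rw [mul_inv_rev, inv_inv, ← mul_right_inj f, ← mul_left_inj t']
            simp [mul_assoc, heq]
          rw [this]
          exact N.inv_mem htt
        subst hff
        rw [mul_left_cancel heq]
    have hTm' : (m : ℝ) ≤ 2 * (F n).card / T.card := by
      rw [le_div_iff₀ hTpos, mul_comm]
      exact le_trans (by exact_mod_cast hTm) hcard
    have hlog : Real.log (coverNumber (joinCover (F n) 𝒰)) ≤
        Real.log N.index + m * Real.log (Nat.card A) := by
      rw [← Real.log_pow, ← Real.log_mul (by positivity) (by positivity)]
      -- The value 0 is covered by the convention `Real.log 0 = 0`.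
      rcases Nat.eq_zero_or_pos (coverNumber (joinCover (F n) 𝒰)) with h0 | h0
      · rw [h0, Nat.cast_zero, Real.log_zero]
        exact Real.log_nonneg (one_le_mul_of_one_le_of_one_le hindex (one_le_pow₀ hk))
      · exact Real.log_le_log (by exact_mod_cast h0) (by exact_mod_cast hcov)
    calc Real.log (coverNumber (joinCover (F n) 𝒰)) / (F n).card
        ≤ (Real.log N.index + 2 * (F n).card / T.card * Real.log (Nat.card A)) / (F n).card := by
          gcongr
          refine hlog.trans ?_
          gcongr
      _ = _ := by field_simp
  have hlim : Tendsto (fun n => Real.log N.index / (F n).card + 2 * Real.log (Nat.card A) / T.card)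
      atTop (𝓝 (2 * Real.log (Nat.card A) / T.card)) := by
    have h1 : Tendsto (fun n => Real.log N.index / ((F n).card : ℝ)) atTop (𝓝 0) :=
      tendsto_const_nhds.div_atTop (tendsto_natCast_atTop_atTop.comp hF.tendsto_card)
    simpa using h1.add_const (2 * Real.log (Nat.card A) / T.card)
  have hlim' := (continuous_coe_real_ereal.tendsto _).comp hlim
  rw [← hlim'.limsup_eq]
  refine limsup_le_limsup ?_
  filter_upwards [eventually_ge_atTop n₀] with n hn
  exact EReal.coe_le_coe_iff.2 (hmain n hn)

theorem topEntropy_nonneg {X : Type*} [TopologicalSpace X] [MulAction Γ X] (F : ℕ → Finset Γ) :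
    0 ≤ topEntropy F X := by
  have h : IsFiniteOpenCover ({Set.univ} : Set (Set X)) :=
    ⟨Set.finite_singleton _, by simp, by simp⟩
  refine le_trans ?_ (le_iSup₂ (f := fun (𝒰 : Set (Set X)) (_ : IsFiniteOpenCover 𝒰) =>
    limsup (fun n => ((Real.log (coverNumber (joinCover (F n) 𝒰)) / (F n).card : ℝ) : EReal))
      atTop) _ h)
  refine le_limsup_of_frequently_le (Eventually.frequently (Eventually.of_forall fun n => ?_))
  exact EReal.coe_nonneg.2 (div_nonneg (Real.log_natCast_nonneg _) (Nat.cast_nonneg _))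

end Entropy

end PropID

namespace PropID

/-! ### Tilings generated by a two-letter substitution -/

section Substitution

variable {Γ : Type*} [Group Γ]

theorem mem_rightTranslate {S : Finset Γ} {c g : Γ} :
    g ∈ rightTranslate S c ↔ g * c⁻¹ ∈ S := by
  simp only [rightTranslate, Finset.mem_map, mulRightEmbedding_apply]
  constructor
  · rintro ⟨s, hs, rfl⟩
    simpa using hs
  · exact fun h => ⟨_, h, by simp⟩

theorem mul_mem_rightTranslate {S : Finset Γ} {c s : Γ} (hs : s ∈ S) :
    s * c ∈ rightTranslate S c :=
  mem_rightTranslate.2 (by simpa using hs)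

theorem rightTranslate_mul (S : Finset Γ) (g c : Γ) :
    rightTranslate S (g * c) = rightTranslate (rightTranslate S g) c := by
  ext x
  simp [mem_rightTranslate, mul_assoc]

theorem rightTranslate_mono {S T : Finset Γ} (h : S ⊆ T) (c : Γ) :
    rightTranslate S c ⊆ rightTranslate T c := fun _ hx =>
  mem_rightTranslate.2 (h (mem_rightTranslate.1 hx))

theorem rightTranslate_one (S : Finset Γ) : rightTranslate S 1 = S := by
  ext x
  simp [mem_rightTranslate]

variable (Γ) in
/-- Two shapes at every level, together with a partition of each shape into right translates of the
shapes one level below. -/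
structure Substitution where
  shape : ℕ → Bool → Finset Γ
  rule : ℕ → Bool → Finset (Bool × Γ)
  rule_subset : ∀ n b, ∀ q ∈ rule n b, rightTranslate (shape n q.1) q.2 ⊆ shape (n + 1) b
  rule_unique : ∀ n b, ∀ s ∈ shape (n + 1) b,
    ∃! q, q ∈ rule n b ∧ s ∈ rightTranslate (shape n q.1) q.2
  one_mem_shape : ∀ n b, 1 ∈ shape n b
  one_mem_rule : ∀ n, (true, 1) ∈ rule n true
  rule_occurs : ∀ n b b', ∃ g, (b', g) ∈ rule n b
  exhausts : ∀ g, ∃ n, g ∈ shape n true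

namespace Substitution

variable (σ : Substitution Γ)

/-- The tile with label and center `p`. -/
def tile (n : ℕ) (p : Bool × Γ) : Finset Γ := rightTranslate (σ.shape n p.1) p.2

/-- The labelled centers of the partition of `σ.shape (n + k) true` into tiles of level `n`. -/
def pieces : ℕ → ℕ → Set (Bool × Γ)
  | 0, _ => {(true, 1)}
  | k + 1, n => {p | ∃ q ∈ pieces k (n + 1), ∃ r ∈ σ.rule n q.1, p = (r.1, r.2 * q.2)}

/-- By `one_mem_rule` the special shape of one level is the piece centered at 1 of the next special
shape, so starting one level higher only adds pieces. -/
theorem pieces_subset_succ (k n : ℕ) : σ.pieces k n ⊆ σ.pieces (k + 1) n := by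
  induction k generalizing n with
  | zero =>
    rintro p rfl
    exact ⟨(true, 1), rfl, (true, 1), σ.one_mem_rule n, by simp⟩
  | succ k ih =>
    rintro p ⟨q, hq, r, hr, rfl⟩
    exact ⟨q, ih _ hq, r, hr, rfl⟩

theorem pieces_mono (n : ℕ) : Monotone fun k => σ.pieces k n :=
  monotone_nat_of_le_succ fun k => σ.pieces_subset_succ k n

theorem tile_rule (n : ℕ) (q r : Bool × Γ) :
    σ.tile n (r.1, r.2 * q.2) = rightTranslate (rightTranslate (σ.shape n r.1) r.2) q.2 :=
  rightTranslate_mul _ _ _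

theorem tile_rule_subset {n : ℕ} {q r : Bool × Γ} (hr : r ∈ σ.rule n q.1) :
    σ.tile n (r.1, r.2 * q.2) ⊆ σ.tile (n + 1) q := by
  rw [tile_rule]
  exact rightTranslate_mono (σ.rule_subset n _ r hr) _

theorem exists_rule_of_mem_tile {n : ℕ} {q : Bool × Γ} {g : Γ} (hg : g ∈ σ.tile (n + 1) q) :
    ∃ r ∈ σ.rule n q.1, g ∈ σ.tile n (r.1, r.2 * q.2) := by
  obtain ⟨r, ⟨hr, hgr⟩, -⟩ := σ.rule_unique n q.1 _ (mem_rightTranslate.1 hg)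
  exact ⟨r, hr, by rw [tile_rule]; exact mem_rightTranslate.2 hgr⟩

theorem rule_eq_of_mem_tile {n : ℕ} {q r r' : Bool × Γ} {g : Γ} (hr : r ∈ σ.rule n q.1)
    (hr' : r' ∈ σ.rule n q.1) (hg : g ∈ σ.tile n (r.1, r.2 * q.2))
    (hg' : g ∈ σ.tile n (r'.1, r'.2 * q.2)) : r = r' := by
  have hgq := mem_rightTranslate.1 (σ.tile_rule_subset hr hg)
  rw [tile_rule] at hg hg'
  exact (σ.rule_unique n q.1 _ hgq).unique ⟨hr, mem_rightTranslate.1 hg⟩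
    ⟨hr', mem_rightTranslate.1 hg'⟩

theorem tile_subset_of_mem_pieces {k n : ℕ} {p : Bool × Γ} (hp : p ∈ σ.pieces k n) :
    σ.tile n p ⊆ σ.shape (n + k) true := by
  induction k generalizing n p with
  | zero =>
    rw [Set.mem_singleton_iff.1 hp]
    exact (rightTranslate_one _).subset
  | succ k ih =>
    obtain ⟨q, hq, r, hr, rfl⟩ := hp
    rw [show n + (k + 1) = n + 1 + k by omega]
    exact (σ.tile_rule_subset hr).trans (ih hq)

theorem exists_piece {k n : ℕ} {g : Γ} (hg : g ∈ σ.shape (n + k) true) :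
    ∃ p ∈ σ.pieces k n, g ∈ σ.tile n p := by
  induction k generalizing n with
  | zero => exact ⟨(true, 1), rfl, (rightTranslate_one _).symm.subset hg⟩
  | succ k ih =>
    rw [show n + (k + 1) = n + 1 + k by omega] at hg
    obtain ⟨q, hq, hgq⟩ := ih hg
    obtain ⟨r, hr, hgr⟩ := σ.exists_rule_of_mem_tile hgq
    exact ⟨_, ⟨q, hq, r, hr, rfl⟩, hgr⟩

theorem piece_unique {k n : ℕ} {g : Γ} {p p' : Bool × Γ} (hp : p ∈ σ.pieces k n)
    (hp' : p' ∈ σ.pieces k n) (hg : g ∈ σ.tile n p) (hg' : g ∈ σ.tile n p') : p = p' := by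
  induction k generalizing n p p' with
  | zero => rw [Set.mem_singleton_iff.1 hp, Set.mem_singleton_iff.1 hp']
  | succ k ih =>
    obtain ⟨q, hq, r, hr, rfl⟩ := hp
    obtain ⟨q', hq', r', hr', rfl⟩ := hp'
    obtain rfl := ih hq hq' (σ.tile_rule_subset hr hg) (σ.tile_rule_subset hr' hg')
    rw [σ.rule_eq_of_mem_tile hr hr' hg hg']

theorem shape_mono : Monotone fun n => σ.shape n true :=
  monotone_nat_of_le_succ fun n => by
    have h := σ.rule_subset n true _ (σ.one_mem_rule n)
    rwa [rightTranslate_one] at h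

/-- The labelled centers of the tiling of level `n`. -/
def level (n : ℕ) : Set (Bool × Γ) := ⋃ k, σ.pieces k n

theorem one_mem_level (n : ℕ) : (true, 1) ∈ σ.level n := Set.mem_iUnion.2 ⟨0, rfl⟩

theorem mem_level_iff {n : ℕ} {p : Bool × Γ} :
    p ∈ σ.level n ↔ ∃ q ∈ σ.level (n + 1), ∃ r ∈ σ.rule n q.1, p = (r.1, r.2 * q.2) := by
  constructor
  · intro hp
    obtain ⟨k, hk⟩ := Set.mem_iUnion.1 hp
    obtain ⟨q, hq, r, hr, rfl⟩ := σ.pieces_subset_succ k n hk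
    exact ⟨q, Set.mem_iUnion.2 ⟨k, hq⟩, r, hr, rfl⟩
  · rintro ⟨q, hq, r, hr, rfl⟩
    obtain ⟨k, hk⟩ := Set.mem_iUnion.1 hq
    exact Set.mem_iUnion.2 ⟨k + 1, q, hk, r, hr, rfl⟩

/-- Every element lies in a special shape of high level, which is cut into disjoint pieces;
monotonicity of `pieces` places any two candidate tiles in a common cutting. -/
theorem existsUnique_mem_level (n : ℕ) (g : Γ) : ∃! p, p ∈ σ.level n ∧ g ∈ σ.tile n p := by
  obtain ⟨m, hm⟩ := σ.exhausts g
  obtain ⟨p, hp, hgp⟩ := σ.exists_piece (n := n) (σ.shape_mono (Nat.le_add_left m n) hm)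
  refine ⟨p, ⟨Set.mem_iUnion.2 ⟨m, hp⟩, hgp⟩, ?_⟩
  rintro p' ⟨hp', hgq⟩
  obtain ⟨k, hk⟩ := Set.mem_iUnion.1 hp'
  exact σ.piece_unique (σ.pieces_mono n (le_max_left k m) hk)
    (σ.pieces_mono n (le_max_right k m) hp) hgq hgp

/-- The set of centers with a given label. -/
def centers (n : ℕ) (b : Bool) : Set Γ := {c | (b, c) ∈ σ.level n}

theorem centers_disjoint (n : ℕ) {b b' : Bool} (h : b ≠ b') :
    Disjoint (σ.centers n b) (σ.centers n b') := by
  refine Set.disjoint_left.2 fun c hc hc' => h ?_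
  have hmem : ∀ b, c ∈ σ.tile n (b, c) := fun b => by
    rw [tile, mem_rightTranslate]
    simpa using σ.one_mem_shape n b
  exact congrArg Prod.fst
    ((σ.existsUnique_mem_level n c).unique ⟨hc, hmem b⟩ ⟨hc', hmem b'⟩)

open Classical in
/-- The tiling of level `n`. -/
noncomputable def tiling (n : ℕ) : Tiling Γ where
  pairs := Finset.univ.image fun b => (σ.shape n b, σ.centers n b)
  shape_nonempty := by
    intro p hp
    obtain ⟨b, -, rfl⟩ := Finset.mem_image.1 hp
    exact ⟨1, σ.one_mem_shape n b⟩
  existsUnique_tile := by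
    intro g
    obtain ⟨⟨b, c⟩, ⟨hp, hg⟩, huniq⟩ := σ.existsUnique_mem_level n g
    refine ⟨((σ.shape n b, σ.centers n b), c),
      ⟨Finset.mem_image_of_mem _ (Finset.mem_univ b), hp, hg⟩, ?_⟩
    rintro ⟨p, c'⟩ ⟨hp', hc', hg'⟩
    obtain ⟨b', -, rfl⟩ := Finset.mem_image.1 hp'
    have h := huniq (b', c') ⟨hc', hg'⟩
    simp only [Prod.mk.injEq] at h
    rw [h.1, h.2]
  centers_disjoint := by
    intro p hp q hq hne
    obtain ⟨b, -, rfl⟩ := Finset.mem_image.1 hp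
    obtain ⟨b', -, rfl⟩ := Finset.mem_image.1 hq
    exact σ.centers_disjoint n fun h => hne (by rw [h])

theorem mem_pairs {n : ℕ} {p : Finset Γ × Set Γ} :
    p ∈ (σ.tiling n).pairs ↔ ∃ b, p = (σ.shape n b, σ.centers n b) := by
  simp only [tiling, Finset.mem_image, Finset.mem_univ, true_and, eq_comm]

theorem isShape_iff {n : ℕ} {S : Finset Γ} :
    (σ.tiling n).IsShape S ↔ ∃ b, S = σ.shape n b := by
  simp only [Tiling.IsShape, mem_pairs, Prod.mk.injEq]
  exact ⟨fun ⟨_, b, h, _⟩ => ⟨b, h⟩, fun ⟨b, h⟩ => ⟨_, b, h, rfl⟩⟩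

theorem isCenter_iff {n : ℕ} {S : Finset Γ} {c : Γ} :
    (σ.tiling n).IsCenter S c ↔ ∃ b, S = σ.shape n b ∧ (b, c) ∈ σ.level n := by
  simp only [Tiling.IsCenter, mem_pairs, Prod.mk.injEq]
  exact ⟨fun ⟨_, ⟨b, h, h'⟩, hc⟩ => ⟨b, h, by subst h'; exact hc⟩,
    fun ⟨b, h, hc⟩ => ⟨_, ⟨b, h, rfl⟩, hc⟩⟩

theorem isTightlyNested : IsTightlyNested σ.tiling := by
  classical
  intro n p hp
  obtain ⟨b, rfl⟩ := σ.mem_pairs.1 hp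
  refine ⟨(σ.rule n b).image fun q => (σ.shape n q.1, q.2), ?_, ?_, ?_, ?_⟩
  · intro q hq
    obtain ⟨r, -, rfl⟩ := Finset.mem_image.1 hq
    exact σ.isShape_iff.2 ⟨_, rfl⟩
  · intro q hq
    obtain ⟨r, hr, rfl⟩ := Finset.mem_image.1 hq
    exact σ.rule_subset n b r hr
  · intro s hs
    obtain ⟨r, ⟨hr, hsr⟩, huniq⟩ := σ.rule_unique n b s hs
    refine ⟨_, ⟨Finset.mem_image_of_mem _ hr, hsr⟩, ?_⟩
    rintro q ⟨hq, hsq⟩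
    obtain ⟨r', hr', rfl⟩ := Finset.mem_image.1 hq
    rw [huniq r' ⟨hr', hsq⟩]
  · intro c hc q hq
    obtain ⟨r, hr, rfl⟩ := Finset.mem_image.1 hq
    exact σ.isCenter_iff.2 ⟨r.1, rfl, σ.mem_level_iff.2 ⟨(b, c), hc, r, hr, rfl⟩⟩

/-- A tile of level `n + 1` with label `b'` contains a center labelled `b` at a relative position
depending only on `b'` and `b`, so a center is always within bounded reach. -/
theorem isSyndetic_centers (n : ℕ) (b : Bool) : IsSyndetic (σ.centers n b) := by
  classical
  choose r hr using σ.rule_occurs n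
  refine ⟨Finset.univ.biUnion fun b' => (σ.shape (n + 1) b').image fun s => s * (r b' b)⁻¹,
    fun g => ?_⟩
  obtain ⟨⟨b', c⟩, ⟨hp, hg⟩, -⟩ := σ.existsUnique_mem_level (n + 1) g
  refine ⟨g * c⁻¹ * (r b' b)⁻¹, Finset.mem_biUnion.2 ⟨b', Finset.mem_univ _,
    Finset.mem_image_of_mem _ (mem_rightTranslate.1 hg)⟩, r b' b * c,
    σ.mem_level_iff.2 ⟨(b', c), hp, (b, r b' b), hr b' b, rfl⟩, by simp [mul_assoc]⟩

theorem finset_subset_tile (F : Finset Γ) : ∃ n T, (σ.tiling n).IsTile T ∧ F ⊆ T := by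
  choose m hm using σ.exhausts
  refine ⟨F.sup m, _, ⟨_, 1, σ.isCenter_iff.2 ⟨true, rfl, σ.one_mem_level _⟩, rfl⟩, fun g hg => ?_⟩
  rw [rightTranslate_one]
  exact σ.shape_mono (Finset.le_sup hg) (hm g)

/-- Only an inequality, because both labels may have the same shape. -/
theorem card_symbols_le (n : ℕ) :
    Finite (σ.tiling n).Symbols ∧ Nat.card (σ.tiling n).Symbols ≤ 3 := by
  let f : Option Bool → (σ.tiling n).Symbols :=
    Option.map fun b => ⟨σ.shape n b, σ.isShape_iff.2 ⟨b, rfl⟩⟩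
  have hf : Function.Surjective f := by
    rintro (_ | ⟨S, hS⟩)
    · exact ⟨none, rfl⟩
    · obtain ⟨b, rfl⟩ := σ.isShape_iff.1 hS
      exact ⟨some b, rfl⟩
  refine ⟨Finite.of_surjective f hf, (Nat.card_le_card_of_surjective f hf).trans ?_⟩
  simp

theorem entropy_le [Infinite Γ] (n : ℕ) (N : Subgroup Γ) [N.Normal] [N.FiniteIndex]
    (hN : ∀ p ∈ σ.level n, p.2 ∈ N) {T : Finset Γ} (hT : T.Nonempty)
    (hTN : ∀ f ∈ T, ∀ f' ∈ T, f⁻¹ * f' ∈ N → f = f') {F : ℕ → Finset Γ} (hF : IsFolnerSeq F) :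
    (σ.tiling n).entropy F ≤ ((2 * Real.log 3 / T.card : ℝ) : EReal) := by
  obtain ⟨hfin, hcard⟩ := σ.card_symbols_le n
  refine (topEntropy_orbitClosure_le (σ.tiling n).coding none N ?_ hT hTN hF).trans ?_
  · intro t ht
    have hex : ∃ S, (σ.tiling n).IsCenter S t := by
      by_contra h
      exact ht (dif_neg h)
    obtain ⟨S, hS⟩ := hex
    obtain ⟨b, -, hb⟩ := σ.isCenter_iff.1 hS
    exact hN _ hb
  · have : Nonempty (σ.tiling n).Symbols := ⟨none⟩
    have h0 : (0 : ℝ) < Nat.card (σ.tiling n).Symbols := by exact_mod_cast Nat.card_pos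
    have h3 : (Nat.card (σ.tiling n).Symbols : ℝ) ≤ 3 := by exact_mod_cast hcard
    refine EReal.coe_le_coe_iff.2 ?_
    gcongr

end Substitution

end Substitution

end PropID

namespace PropID

/-! ### Almost equivariant and generic sections of finite quotients -/

section Section

variable {Γ G : Type*} [Group Γ] [Group G] [DecidableEq G]

theorem sum_card_filter_mul_mem [Fintype G] (φ : Γ →* G) (S : Finset Γ) (A : Finset G) :
    ∑ c : G, (S.filter fun σ => φ σ * c ∈ A).card = S.card * A.card := by
  simp_rw [Finset.card_filter]
  rw [Finset.sum_comm, Finset.card_eq_sum_ones S, Finset.sum_mul]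
  refine Finset.sum_congr rfl fun σ _ => ?_
  rw [← Finset.card_filter, one_mul]
  refine Finset.card_bij' (fun c _ => φ σ * c) (fun a _ => (φ σ)⁻¹ * a) ?_ ?_ ?_ ?_ <;> simp

/-- Some translate of `S` has small boundary relative to `A`. -/
theorem exists_translate_small_boundary [Fintype G] (φ : Γ →* G) {S B : Finset Γ} {η : ℝ}
    (hS : S.Nonempty) (hB : (B.card : ℝ) ≤ η * S.card) {A : Finset G} (hA : A.Nonempty) :
    ∃ c : G, (S.filter fun σ => φ σ * c ∈ A).Nonempty ∧
      ((B.filter fun σ => φ σ * c ∈ A).card : ℝ) ≤ η * (S.filter fun σ => φ σ * c ∈ A).card := by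
  -- Averaging: summed over all `c`, the two counts are `|B| |A|` and `|S| |A|`, so the inequality
  -- cannot fail for every `c` with nonempty intersection.
  by_contra! hcon
  have hle : ∀ c : G, η * (S.filter fun σ => φ σ * c ∈ A).card ≤
      (B.filter fun σ => φ σ * c ∈ A).card := by
    intro c
    rcases (S.filter fun σ => φ σ * c ∈ A).eq_empty_or_nonempty with h | h
    · rw [h]
      simp
    · exact (hcon c h).le
  obtain ⟨σ, hσ⟩ := hS
  obtain ⟨a, ha⟩ := hA
  have hne : (S.filter fun τ => φ τ * ((φ σ)⁻¹ * a) ∈ A).Nonempty :=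
    ⟨σ, Finset.mem_filter.2 ⟨hσ, by simpa using ha⟩⟩
  have hlt := Finset.sum_lt_sum (s := Finset.univ) (fun c _ => hle c)
    ⟨(φ σ)⁻¹ * a, Finset.mem_univ _, hcon _ hne⟩
  rw [← Finset.mul_sum, ← Nat.cast_sum, ← Nat.cast_sum, sum_card_filter_mul_mem,
    sum_card_filter_mul_mem] at hlt
  push_cast at hlt
  nlinarith [mul_le_mul_of_nonneg_right hB (Nat.cast_nonneg (α := ℝ) A.card)]

section

variable [DecidableEq Γ]

/-- The pairs at which the section `s` over `A` fails to be equivariant under `E`. -/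
def badPairs (φ : Γ →* G) (E : Finset Γ) (A : Finset G) (s : G → Γ) : Finset (Γ × G) :=
  (E ×ˢ A).filter fun p => φ p.1 * p.2 ∈ A ∧ s (φ p.1 * p.2) ≠ p.1 * s p.2

/-- If `S` is almost invariant and embeds into the finite quotient `G`, then every subset of `G` has
an almost equivariant section. -/
theorem exists_section [Fintype G] (φ : Γ →* G) (hφ : Function.Surjective φ) {S E : Finset Γ}
    {η : ℝ} (hS : S.Nonempty) (hinj : Set.InjOn φ S) (hE : ∀ t ∈ E, t⁻¹ ∈ E)
    (hSE : ((S.filter fun s => ∃ t ∈ E, t * s ∉ S).card : ℝ) ≤ η * S.card) (A : Finset G) :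
    ∃ s : G → Γ, (∀ a ∈ A, φ (s a) = a) ∧
      ((badPairs φ E A s).card : ℝ) ≤ 2 * E.card * η * A.card := by
  -- Greedy choice: a translate of `S` whose part `P` in `A` has small boundary is lifted through
  -- `S` itself, and the rest of `A` is left to the induction.
  induction A using Finset.strongInduction with
  | H A ih =>
  rcases A.eq_empty_or_nonempty with rfl | hA
  · exact ⟨fun _ => 1, by simp, by simp [badPairs]⟩
  set B := S.filter fun s => ∃ t ∈ E, t * s ∉ S with hBdef
  obtain ⟨c, hne, hsmall⟩ :=
    exists_translate_small_boundary φ hS hSE hA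
  obtain ⟨c', rfl⟩ := hφ c
  set Sc := S.filter fun σ => φ σ * φ c' ∈ A with hSc
  set Bc := B.filter fun σ => φ σ * φ c' ∈ A with hBc
  set P := Sc.image fun σ => φ σ * φ c' with hP
  have hPA : P ⊆ A := by
    intro p hp
    obtain ⟨σ, hσ, rfl⟩ := Finset.mem_image.1 hp
    exact (Finset.mem_filter.1 hσ).2
  have hPcard : P.card = Sc.card := Finset.card_image_of_injOn fun σ hσ τ hτ h =>
    hinj (Finset.mem_filter.1 hσ).1 (Finset.mem_filter.1 hτ).1 (mul_right_cancel h)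
  obtain ⟨s₀, hs₀, hbad₀⟩ := ih (A \ P) (Finset.sdiff_ssubset hPA (hne.image _))
  let s : G → Γ := fun a => if a ∈ P then Function.invFunOn φ S (a * (φ c')⁻¹) * c' else s₀ a
  have hsP : ∀ σ ∈ S, φ σ * φ c' ∈ P → s (φ σ * φ c') = σ * c' := by
    intro σ hσ hmem
    simp only [s, if_pos hmem, mul_inv_cancel_right]
    rw [hinj.leftInvOn_invFunOn hσ]
  have hout : ∀ σ ∈ S, φ σ * φ c' ∈ A → φ σ * φ c' ∈ P := fun σ hσ h =>
    Finset.mem_image_of_mem _ (Finset.mem_filter.2 ⟨hσ, h⟩)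
  refine ⟨s, ?_, ?_⟩
  · intro a ha
    by_cases haP : a ∈ P
    · obtain ⟨σ, hσ, rfl⟩ := Finset.mem_image.1 haP
      rw [hsP σ (Finset.mem_filter.1 hσ).1 haP, map_mul]
    · simp only [s, if_neg haP]
      exact hs₀ a (Finset.mem_sdiff.2 ⟨ha, haP⟩)
  -- A new bad pair `(t, a)` has `a` or `φ t * a` in `P`. The corresponding point of `S` is then
  -- moved out of `S` by `t` or by `t⁻¹`, so it lies in `Bc`; the two cases account for the factor
  -- 2.
  · have hsub : badPairs φ E A s ⊆ badPairs φ E (A \ P) s₀ ∪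
        ((E ×ˢ Bc).image (fun p => (p.1, φ p.2 * φ c')) ∪
          (E ×ˢ Bc).image (fun p => (p.1, (φ p.1)⁻¹ * (φ p.2 * φ c')))) := by
      rintro ⟨t, a⟩ hta
      simp only [badPairs, Finset.mem_filter, Finset.mem_product] at hta
      obtain ⟨⟨ht, ha⟩, hta, hne⟩ := hta
      simp only [Finset.mem_union]
      by_cases haP : a ∈ P
      · refine Or.inr (Or.inl ?_)
        obtain ⟨σ, hσ, rfl⟩ := Finset.mem_image.1 haP
        obtain ⟨hσS, hσA⟩ := Finset.mem_filter.1 hσ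
        refine Finset.mem_image.2 ⟨(t, σ), Finset.mem_product.2 ⟨ht, Finset.mem_filter.2
          ⟨Finset.mem_filter.2 ⟨hσS, t, ht, fun htσ => hne ?_⟩, hσA⟩⟩, rfl⟩
        rw [← mul_assoc, ← map_mul] at hta ⊢
        rw [hsP _ htσ (hout _ htσ hta), hsP σ hσS haP, mul_assoc]
      · by_cases htP : φ t * a ∈ P
        · refine Or.inr (Or.inr ?_)
          obtain ⟨σ, hσ, hσa⟩ := Finset.mem_image.1 htP
          obtain ⟨hσS, hσA⟩ := Finset.mem_filter.1 hσ
          have haeq : (φ t)⁻¹ * (φ σ * φ c') = a := by simp [hσa]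
          refine Finset.mem_image.2 ⟨(t, σ), Finset.mem_product.2 ⟨ht, Finset.mem_filter.2
            ⟨Finset.mem_filter.2 ⟨hσS, t⁻¹, hE t ht, fun htσ => haP ?_⟩, hσA⟩⟩,
            by rw [haeq]⟩
          have h1 : φ (t⁻¹ * σ) * φ c' = a := by rw [← haeq]; simp [mul_assoc]
          have h2 := hout _ htσ (h1.symm ▸ ha)
          rwa [h1] at h2
        · refine Or.inl (Finset.mem_filter.2 ⟨Finset.mem_product.2
            ⟨ht, Finset.mem_sdiff.2 ⟨ha, haP⟩⟩, Finset.mem_sdiff.2 ⟨hta, htP⟩, ?_⟩)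
          simpa only [s, if_neg haP, if_neg htP] using hne
    have hcard : (badPairs φ E A s).card ≤
        (badPairs φ E (A \ P) s₀).card + (E.card * Bc.card + E.card * Bc.card) := by
      refine (Finset.card_le_card hsub).trans ((Finset.card_union_le _ _).trans ?_)
      refine Nat.add_le_add_left ((Finset.card_union_le _ _).trans ?_) _
      rw [← Finset.card_product]
      exact Nat.add_le_add Finset.card_image_le Finset.card_image_le
    have hA' : ((A \ P).card : ℝ) + Sc.card = A.card := by
      rw [← hPcard]
      exact_mod_cast Finset.card_sdiff_add_card_eq_card hPA
    calc ((badPairs φ E A s).card : ℝ)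
        ≤ (badPairs φ E (A \ P) s₀).card + (E.card * Bc.card + E.card * Bc.card) := by
          exact_mod_cast hcard
      _ ≤ 2 * E.card * η * (A \ P).card + (E.card * (η * Sc.card) + E.card * (η * Sc.card)) := by
          gcongr
      _ = 2 * E.card * η * A.card := by rw [← hA']; ring

/-- A pair `(t, a)` can become bad only if `a` or `φ t * a` lies in `M`. -/
theorem card_badPairs_le (φ : Γ →* G) (E : Finset Γ) (A M : Finset G) {s s' : G → Γ}
    (h : ∀ a ∉ M, s' a = s a) :
    (badPairs φ E A s').card ≤ (badPairs φ E A s).card + 2 * (E.card * M.card) := by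
  have hsub : badPairs φ E A s' ⊆ badPairs φ E A s ∪
      ((E ×ˢ M) ∪ (E ×ˢ M).image (fun p => (p.1, (φ p.1)⁻¹ * p.2))) := by
    rintro ⟨t, a⟩ hta
    simp only [badPairs, Finset.mem_filter, Finset.mem_product] at hta
    obtain ⟨⟨ht, ha⟩, hta, hne⟩ := hta
    simp only [Finset.mem_union]
    by_cases haM : a ∈ M
    · exact Or.inr (Or.inl (Finset.mem_product.2 ⟨ht, haM⟩))
    · by_cases htM : φ t * a ∈ M
      · exact Or.inr (Or.inr (Finset.mem_image.2
          ⟨(t, φ t * a), Finset.mem_product.2 ⟨ht, htM⟩, by simp⟩))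
      · refine Or.inl (Finset.mem_filter.2 ⟨Finset.mem_product.2 ⟨ht, ha⟩, hta, ?_⟩)
        rwa [← h _ haM, ← h _ htM]
  refine (Finset.card_le_card hsub).trans ((Finset.card_union_le _ _).trans ?_)
  refine Nat.add_le_add_left ((Finset.card_union_le _ _).trans ?_) _
  rw [two_mul, ← Finset.card_product]
  exact Nat.add_le_add le_rfl Finset.card_image_le

/-- The range of an almost equivariant section is almost invariant. -/
theorem card_filter_image_section_le (φ : Γ →* G) {E : Finset Γ} {A : Finset G} {s : G → Γ}
    (hA : ∀ t ∈ E, ∀ a ∈ A, φ t * a ∈ A) :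
    ((A.image s).filter fun d => ∃ t ∈ E, t * d ∉ A.image s).card ≤ (badPairs φ E A s).card := by
  refine (Finset.card_le_card (t := (badPairs φ E A s).image fun p => s p.2) ?_).trans
    Finset.card_image_le
  intro d hd
  obtain ⟨hd, t, ht, htd⟩ := Finset.mem_filter.1 hd
  obtain ⟨a, ha, rfl⟩ := Finset.mem_image.1 hd
  refine Finset.mem_image.2 ⟨(t, a), Finset.mem_filter.2 ⟨Finset.mem_product.2 ⟨ht, ha⟩,
    hA t ht a ha, fun h => htd ?_⟩, rfl⟩
  rw [← h]
  exact Finset.mem_image_of_mem _ (hA t ht a ha)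

end

/-- Finitely many translates of a subgroup of infinite index do not cover a subgroup of finite
index. -/
theorem exists_mem_forall_ne_mul {N L : Subgroup Γ} [N.FiniteIndex] (hL : ¬ L.FiniteIndex)
    {ι : Type*} (I : Finset ι) (w y : ι → Γ) :
    ∃ δ ∈ N, ∀ i ∈ I, ∀ h ∈ L, δ ≠ w i * h * (y i)⁻¹ := by
  by_contra! hcon
  have := Fintype.ofFinite (Γ ⧸ N)
  -- Since `w h y⁻¹ = w y⁻¹ (y h y⁻¹)`, failure would cover `N`, and with coset representatives all
  -- of `Γ`, by finitely many left cosets of conjugates of `L`. By B. H. Neumann's lemma one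
  -- conjugate would have finite index.
  let K : ι → Subgroup Γ := fun i => L.map (MulAut.conj (y i)).toMonoidHom
  have hcov : ⋃ p ∈ (Finset.univ : Finset (Γ ⧸ N)) ×ˢ I,
      (p.1.out * (w p.2 * (y p.2)⁻¹)) • ((K p.2 : Subgroup Γ) : Set Γ) = Set.univ := by
    refine Set.eq_univ_of_forall fun g => ?_
    have hg : ((g : Γ ⧸ N).out)⁻¹ * g ∈ N :=
      QuotientGroup.eq.1 (QuotientGroup.out_eq' (g : Γ ⧸ N))
    obtain ⟨i, hi, h, hh, heq⟩ := hcon _ hg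
    refine Set.mem_iUnion₂.2 ⟨((g : Γ ⧸ N), i), Finset.mem_product.2 ⟨Finset.mem_univ _, hi⟩,
      Set.mem_smul_set.2 ⟨y i * h * (y i)⁻¹, ⟨h, hh, by simp⟩, ?_⟩⟩
    rw [smul_eq_mul, ← mul_right_inj ((g : Γ ⧸ N).out)⁻¹, heq]
    simp [mul_assoc]
  obtain ⟨p, -, hp⟩ := Subgroup.exists_finiteIndex_of_leftCoset_cover hcov
  exact hL ⟨fun h0 =>
    hp.index_ne_zero ((Subgroup.index_map_equiv L (MulAut.conj (y p.2))).trans h0)⟩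

/-- Representatives can be chosen so generically that the remainders of the points of `X` stay
distinct modulo a subgroup `L` of infinite index. -/
theorem exists_generic_section (φ : Γ →* G) (hφ : Function.Surjective φ) [Finite G]
    {L : Subgroup Γ} (hL : ¬ L.FiniteIndex) (X : Finset Γ)
    (hX : ∀ x ∈ X, ∀ x' ∈ X, x⁻¹ * x' ∈ L → x = x') :
    ∃ d : G → Γ, (∀ e, φ (d e) = e) ∧ ∀ x ∈ X, ∀ x' ∈ X,
      ((d (φ x))⁻¹ * x)⁻¹ * ((d (φ x'))⁻¹ * x') ∈ L → x = x' := by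
  have := Fintype.ofFinite G
  have hker : φ.ker.FiniteIndex := Subgroup.finiteIndex_ker φ
  suffices h : ∀ P : Finset G, ∃ d : G → Γ, (∀ e, φ (d e) = e) ∧ ∀ x ∈ X, φ x ∈ P → ∀ x' ∈ X,
      φ x' ∈ P → ((d (φ x))⁻¹ * x)⁻¹ * ((d (φ x'))⁻¹ * x') ∈ L → x = x' by
    obtain ⟨d, hd, h⟩ := h Finset.univ
    exact ⟨d, hd, fun x hx x' hx' => h x hx (Finset.mem_univ _) x' hx' (Finset.mem_univ _)⟩
  intro P
  induction P using Finset.induction_on with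
  | empty =>
    choose d hd using hφ
    exact ⟨d, hd, by simp⟩
  | insert e P he ih =>
    obtain ⟨d, hd, ih⟩ := ih
    -- Only the representative of `e` moves, by a `δ` in the kernel avoiding the finitely many
    -- translates of `L` that would create a collision with another class. Two points over `e` have
    -- quotient `x⁻¹ * x'` whatever the representative.
    obtain ⟨δ, hδ, hne⟩ := exists_mem_forall_ne_mul (N := φ.ker) hL (X ×ˢ X)
      (fun p => (d e)⁻¹ * p.1) (fun p => (d (φ p.2))⁻¹ * p.2)
    have hlt : ∀ x ∈ X, φ x = e → ∀ x' ∈ X, ∀ h ∈ L,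
        (d e * δ)⁻¹ * x * h ≠ (d (φ x'))⁻¹ * x' := by
      intro x hx _ x' hx' h hh heq
      refine hne (x, x') (Finset.mem_product.2 ⟨hx, hx'⟩) h hh ?_
      rw [eq_mul_inv_iff_mul_eq, ← heq]
      simp [mul_assoc]
    refine ⟨Function.update d e (d e * δ), fun e' => ?_, ?_⟩
    · rcases eq_or_ne e' e with rfl | hne'
      · rw [Function.update_self, map_mul, hd, MonoidHom.mem_ker.1 hδ, mul_one]
      · rw [Function.update_of_ne hne', hd]
    · intro x hx hxP x' hx' hxP' hmem
      by_cases h1 : φ x = e <;> by_cases h2 : φ x' = e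
      · rw [h1, h2, Function.update_self] at hmem
        refine hX x hx x' hx' ?_
        simpa [mul_assoc] using hmem
      · rw [h1, Function.update_self, Function.update_of_ne h2] at hmem
        exact (hlt x hx h1 x' hx' _ hmem (by simp [mul_assoc])).elim
      · rw [h2, Function.update_self, Function.update_of_ne h1] at hmem
        exact (hlt x' hx' h2 x hx _ (L.inv_mem hmem) (by simp [mul_assoc])).elim
      · rw [Function.update_of_ne h1, Function.update_of_ne h2] at hmem
        exact ih x hx (Finset.mem_of_mem_insert_of_ne hxP h1) x' hx'
          (Finset.mem_of_mem_insert_of_ne hxP' h2) hmem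

end Section

end PropID

namespace PropID

/-! ### Large quotients and transversals with prescribed elements -/

section Groups

variable {Γ : Type*} [Group Γ]

theorem exists_normal_avoiding [Group.ResiduallyFinite Γ] (N : Subgroup Γ) [N.Normal]
    [N.FiniteIndex] (Ξ : Finset Γ) :
    ∃ Δ ≤ N, Δ.Normal ∧ Δ.FiniteIndex ∧ ∀ x ∈ Ξ, x ∈ Δ → x = 1 := by
  classical
  induction Ξ using Finset.induction_on with
  | empty => exact ⟨N, le_rfl, inferInstance, inferInstance, by simp⟩
  | insert x Ξ hx ih =>
    obtain ⟨Δ, hΔ, hn, hf, h⟩ := ih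
    by_cases hx1 : x = 1
    · exact ⟨Δ, hΔ, hn, hf, fun y hy hyΔ => (Finset.mem_insert.1 hy).elim
        (fun h' => h'.trans hx1) fun h' => h y h' hyΔ⟩
    · obtain ⟨M, hM⟩ := Group.exists_finiteIndexNormalSubgroup_notMem x hx1
      refine ⟨Δ ⊓ M.toSubgroup, inf_le_left.trans hΔ, inferInstance, inferInstance, ?_⟩
      intro y hy hyΔ
      rcases Finset.mem_insert.1 hy with rfl | hy
      · exact (hM hyΔ.2).elim
      · exact h y hy hyΔ.1

theorem exists_conjugators {a : Γ} (ha : (conjugatesOf a).Infinite) (B : ℕ) :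
    ∃ R : Finset Γ, R.card = B ∧
      ∀ r ∈ R, ∀ r' ∈ R, r * a * r⁻¹ = r' * a * r'⁻¹ → r = r' := by
  classical
  obtain ⟨T, hT, rfl⟩ := ha.exists_subset_card_eq B
  have h : ∀ t : T, ∃ g : Γ, g * a * g⁻¹ = t := fun t => isConj_iff.1 (hT t.2)
  choose g hg using h
  refine ⟨Finset.univ.image g, ?_, ?_⟩
  · rw [Finset.card_image_of_injective, Finset.card_univ, Fintype.card_coe]
    intro t t' htt
    exact Subtype.ext (by rw [← hg t, ← hg t', htt])
  · intro r hr r' hr' heq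
    obtain ⟨t, -, rfl⟩ := Finset.mem_image.1 hr
    obtain ⟨t', -, rfl⟩ := Finset.mem_image.1 hr'
    rw [hg, hg] at heq
    rw [Subtype.ext heq]

/-- The conjugate `g a g⁻¹` depends only on the coset `g ⟨a⟩`. -/
theorem not_finiteIndex_zpowers {a : Γ} (ha : (conjugatesOf a).Infinite) :
    ¬ (Subgroup.zpowers a).FiniteIndex := by
  intro hfin
  refine ha (Set.Finite.subset (Set.finite_range fun u : Γ ⧸ Subgroup.zpowers a =>
    u.out * a * u.out⁻¹) ?_)
  intro b hb
  obtain ⟨g, rfl⟩ := isConj_iff.1 hb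
  refine ⟨(g : Γ ⧸ Subgroup.zpowers a), ?_⟩
  obtain ⟨k, hk⟩ := Subgroup.mem_zpowers_iff.1
    (QuotientGroup.eq.1 (QuotientGroup.out_eq' (g : Γ ⧸ Subgroup.zpowers a)))
  have hg : g = (g : Γ ⧸ Subgroup.zpowers a).out * a ^ k := by rw [hk]; simp
  have hcomm : a ^ k * a * (a ^ k)⁻¹ = a := by
    rw [((Commute.refl a).zpow_left k).eq, mul_inv_cancel_right]
  conv_rhs => rw [hg, mul_inv_rev, ← mul_assoc, mul_assoc _ (a ^ k), mul_assoc _ (a ^ k * a), hcomm]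

/-- The image of `⟨a⟩` in a quotient has large index as soon as many conjugates of `a` stay
distinct. -/
theorem card_mul_card_map_zpowers_le {G : Type*} [Group G] [Finite G] (φ : Γ →* G) {a : Γ}
    {R : Finset Γ} (hR : ∀ r ∈ R, ∀ r' ∈ R, φ (r * a * r⁻¹) = φ (r' * a * r'⁻¹) → r = r') :
    R.card * Nat.card ((Subgroup.zpowers a).map φ) ≤ Nat.card G := by
  classical
  have hcomm : ∀ k ∈ (Subgroup.zpowers a).map φ, k * φ a * k⁻¹ = φ a := by
    rintro k ⟨h, hh, rfl⟩
    obtain ⟨i, rfl⟩ := Subgroup.mem_zpowers_iff.1 hh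
    rw [map_zpow, ((Commute.refl (φ a)).zpow_left i).eq, mul_inv_cancel_right]
  rw [← Fintype.card_coe R, ← Nat.card_eq_fintype_card, ← Nat.card_prod]
  -- As `φ a` commutes with the image of `⟨a⟩`, conjugating it by `φ r * k` gives `φ (r a r⁻¹)`,
  -- which determines `r`.
  refine Nat.card_le_card_of_injective (fun p => φ p.1 * p.2) ?_
  rintro ⟨r, k⟩ ⟨r', k'⟩ heq
  change φ r * k = φ r' * k' at heq
  have hr : r = r' := by
    refine Subtype.ext (hR r r.2 r' r'.2 ?_)
    have h1 : φ (r * a * (r : Γ)⁻¹) = (φ r * k) * φ a * (φ r * k)⁻¹ := by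
      conv_lhs => rw [map_mul, map_mul, map_inv, ← hcomm k k.2]
      group
    have h2 : φ (r' * a * (r' : Γ)⁻¹) = (φ r' * k') * φ a * (φ r' * k')⁻¹ := by
      conv_lhs => rw [map_mul, map_mul, map_inv, ← hcomm k' k'.2]
      group
    rw [h1, h2, heq]
  subst hr
  rw [Subtype.ext (mul_left_cancel heq)]

theorem exists_transversal_extending {G : Type*} [Group G] [Finite G] (φ : Γ →* G)
    (M : Subgroup Γ) (L₀ : Finset Γ) (hL₀ : ∀ l ∈ L₀, l ∈ M) (hinj : Set.InjOn φ L₀) :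
    ∃ J : Finset Γ, L₀ ⊆ J ∧ (∀ j ∈ J, j ∈ M) ∧ (∀ h ∈ M, ∃ j ∈ J, φ j = φ h) ∧
      Set.InjOn φ J ∧ J.card ≤ Nat.card (M.map φ) := by
  classical
  have := Fintype.ofFinite (M.map φ)
  have h : ∀ q : M.map φ, ∃ g ∈ M, φ g = q ∧ ∀ l ∈ L₀, φ l = q → g = l := by
    intro q
    by_cases hq : ∃ l ∈ L₀, φ l = q
    · obtain ⟨l, hl, hlq⟩ := hq
      exact ⟨l, hL₀ l hl, hlq, fun l' hl' hlq' => hinj hl hl' (hlq.trans hlq'.symm)⟩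
    · obtain ⟨g, hg, hgq⟩ := q.2
      exact ⟨g, hg, hgq, fun l hl hlq => (hq ⟨l, hl, hlq⟩).elim⟩
  choose r hrM hrφ hrL using h
  refine ⟨Finset.univ.image r, ?_, ?_, ?_, ?_, ?_⟩
  · intro l hl
    exact Finset.mem_image.2 ⟨⟨φ l, l, hL₀ l hl, rfl⟩, Finset.mem_univ _, hrL _ l hl rfl⟩
  · intro j hj
    obtain ⟨q, -, rfl⟩ := Finset.mem_image.1 hj
    exact hrM q
  · intro h hh
    exact ⟨_, Finset.mem_image_of_mem r (Finset.mem_univ ⟨φ h, h, hh, rfl⟩), hrφ _⟩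
  · intro j hj j' hj' heq
    obtain ⟨q, -, rfl⟩ := Finset.mem_image.1 hj
    obtain ⟨q', -, rfl⟩ := Finset.mem_image.1 hj'
    rw [hrφ, hrφ] at heq
    rw [Subtype.ext heq]
  · rw [Nat.card_eq_fintype_card]
    exact Finset.card_image_le

/-- A transversal of `N / Δ` which is almost invariant under `E`, contains a translate of `Z`, and
such that `X` lies in finitely many translates of it by elements of `Δ` that are distinct modulo
`H`. -/
theorem exists_transversal [DecidableEq Γ] {H N Δ : Subgroup Γ} [Δ.Normal] [Δ.FiniteIndex]
    (hH : ¬ H.FiniteIndex) (hΔN : Δ ≤ N) {X Z S E : Finset Γ} {η : ℝ} {m : ℕ}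
    (hXN : ∀ x ∈ X, x ∈ N) (h1X : 1 ∈ X) (hX : ∀ x ∈ X, ∀ x' ∈ X, x⁻¹ * x' ∈ H ⊓ Δ → x = x')
    (hZN : ∀ z ∈ Z, z ∈ N) (hZ : ∀ z ∈ Z, ∀ z' ∈ Z, z⁻¹ * z' ∈ Δ → z = z')
    (hm : m ≤ Nat.card (N.map (QuotientGroup.mk' Δ))) (hZX : Z.card * X.card < m)
    (hEN : ∀ t ∈ E, t ∈ N) (hE : ∀ t ∈ E, t⁻¹ ∈ E) (hS : S.Nonempty)
    (hSΔ : ∀ s ∈ S, ∀ s' ∈ S, s⁻¹ * s' ∈ Δ → s = s')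
    (hSE : IsInvariant E η S) :
    ∃ (D Z' : Finset Γ) (c : Γ), (∀ d ∈ D, d ∈ N) ∧ 1 ∈ D ∧ (∀ n ∈ N, ∃ d ∈ D, d⁻¹ * n ∈ Δ) ∧
      (∀ d ∈ D, ∀ d' ∈ D, d⁻¹ * d' ∈ Δ → d = d') ∧ (∀ w ∈ Z', w ∈ Δ) ∧ 1 ∈ Z' ∧
      (∀ w ∈ Z', ∀ w' ∈ Z', w⁻¹ * w' ∈ H → w = w') ∧ X ⊆ D * Z' ∧
      c ∈ N ∧ (∀ z ∈ Z, z * c ∈ D) ∧ m ≤ D.card ∧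
      ((D.filter fun d => ∃ t ∈ E, t * d ∉ D).card : ℝ) ≤
        2 * E.card * (η * D.card + (X.card + Z.card)) := by
  classical
  have := Fintype.ofFinite (Γ ⧸ Δ)
  set φ := QuotientGroup.mk' Δ with hφdef
  have hφ : Function.Surjective φ := QuotientGroup.mk'_surjective Δ
  have hφeq : ∀ g g' : Γ, φ g = φ g' ↔ g⁻¹ * g' ∈ Δ := fun g g' => QuotientGroup.eq
  have hφ1 : ∀ g : Γ, φ g = 1 ↔ g ∈ Δ := fun g => QuotientGroup.eq_one_iff g
  have hNφ : ∀ g : Γ, φ g ∈ N.map φ ↔ g ∈ N := by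
    refine fun g => ⟨?_, fun hg => ⟨g, hg, rfl⟩⟩
    rintro ⟨n, hn, hng⟩
    have := N.mul_mem hn (hΔN ((hφeq n g).1 hng))
    rwa [mul_inv_cancel_left] at this
  set A : Finset (Γ ⧸ Δ) := Finset.univ.filter fun u => u ∈ N.map φ with hA
  have hmemA : ∀ u, u ∈ A ↔ u ∈ N.map φ := by simp [hA]
  have hAcard : A.card = Nat.card (N.map φ) := by
    rw [hA, ← Fintype.card_subtype, ← Nat.card_eq_fintype_card]
  obtain ⟨s, hs, hsbad⟩ := exists_section φ hφ hS
    (fun x hx y hy h => hSΔ x hx y hy ((hφeq x y).1 h)) hE ((isInvariant_iff _ _ _).1 hSE) A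
  have hL : ¬ (H ⊓ Δ).FiniteIndex := fun _ =>
    hH (Subgroup.finiteIndex_of_le (inf_le_left : H ⊓ Δ ≤ H))
  obtain ⟨d, hd, hdX⟩ := exists_generic_section φ hφ hL X hX
  -- The values prescribed over `Z c₀` and over `X` must not compete. At most `|Z| |X|` classes of
  -- `c₀` are excluded, fewer than there are in `N / Δ`.
  obtain ⟨c₀, hc₀N, hc₀⟩ : ∃ c₀ ∈ N, ∀ z ∈ Z, ∀ x ∈ X, φ (z * c₀) ≠ φ x := by
    have hlt : ((Z ×ˢ X).image fun p => φ (p.1⁻¹ * p.2)).card < A.card := by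
      refine Finset.card_image_le.trans_lt ?_
      rw [Finset.card_product, hAcard]
      exact hZX.trans_le hm
    obtain ⟨u, hu, hu'⟩ := Finset.exists_mem_notMem_of_card_lt_card hlt
    obtain ⟨c₀, hc₀, rfl⟩ := (hmemA u).1 hu
    refine ⟨c₀, hc₀, fun z hz x hx h => hu' (Finset.mem_image.2
      ⟨(z, x), Finset.mem_product.2 ⟨hz, hx⟩, ?_⟩)⟩
    simp only [map_mul, map_inv] at h ⊢
    rw [← h, inv_mul_cancel_left]
  set Zc := Z.image fun z => z * c₀ with hZc
  have hZcinj : Set.InjOn φ Zc := by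
    intro x hx y hy h
    obtain ⟨z, hz, rfl⟩ := Finset.mem_image.1 hx
    obtain ⟨z', hz', rfl⟩ := Finset.mem_image.1 hy
    rw [map_mul, map_mul, mul_left_inj, hφeq] at h
    rw [hZ z hz z' hz' h]
  let s₁ : Γ ⧸ Δ → Γ := fun u => if u ∈ Zc.image φ then Function.invFunOn φ Zc u else
    if u ∈ X.image φ then d u else s u
  have hs₁Z : ∀ z ∈ Z, s₁ (φ (z * c₀)) = z * c₀ := by
    intro z hz
    have hmem : z * c₀ ∈ Zc := Finset.mem_image_of_mem _ hz
    simp only [s₁, if_pos (Finset.mem_image_of_mem φ hmem)]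
    exact hZcinj.leftInvOn_invFunOn hmem
  have hs₁X : ∀ x ∈ X, s₁ (φ x) = d (φ x) := by
    intro x hx
    have hnot : φ x ∉ Zc.image φ := by
      intro h
      obtain ⟨y, hy, hyx⟩ := Finset.mem_image.1 h
      obtain ⟨z, hz, rfl⟩ := Finset.mem_image.1 hy
      exact hc₀ z hz x hx hyx
    simp only [s₁, if_neg hnot, if_pos (Finset.mem_image_of_mem φ hx)]
  have hs₁ : ∀ u ∈ A, φ (s₁ u) = u := by
    intro u hu
    by_cases h1 : u ∈ Zc.image φ
    · obtain ⟨y, hy, rfl⟩ := Finset.mem_image.1 h1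
      obtain ⟨z, hz, rfl⟩ := Finset.mem_image.1 hy
      rw [hs₁Z z hz]
    · by_cases h2 : u ∈ X.image φ
      · simp only [s₁, if_neg h1, if_pos h2, hd]
      · simp only [s₁, if_neg h1, if_neg h2, hs u hu]
  have hbad₁ := card_badPairs_le φ E A (X.image φ ∪ Zc.image φ) (s := s) (s' := s₁) fun u hu => by
    rw [Finset.mem_union, not_or] at hu
    simp only [s₁, if_neg hu.1, if_neg hu.2]
  set δ := s₁ 1 with hδ
  have h1A : (1 : Γ ⧸ Δ) ∈ A := (hmemA 1).2 (one_mem _)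
  have hδΔ : δ ∈ Δ := (hφ1 δ).1 (hs₁ 1 h1A)
  -- Right multiplication by `δ⁻¹` brings 1 into the range. It affects neither the equivariance on
  -- the left nor the quotients of remainders, which are all multiplied by `δ` on the left.
  let s₂ : Γ ⧸ Δ → Γ := fun u => s₁ u * δ⁻¹
  have hs₂ : ∀ u ∈ A, φ (s₂ u) = u := by
    intro u hu
    simp only [s₂, map_mul, map_inv, hs₁ u hu, (hφ1 δ).2 hδΔ, inv_one, mul_one]
  have hbad₂ : badPairs φ E A s₂ = badPairs φ E A s₁ := by
    simp only [badPairs, s₂, ← mul_assoc, ne_eq, mul_left_inj]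
  have hDcard : (A.image s₂).card = A.card := Finset.card_image_of_injOn fun u hu v hv h => by
    rw [← hs₂ u hu, ← hs₂ v hv, h]
  have hXA : ∀ x ∈ X, φ x ∈ A := fun x hx => (hmemA _).2 ((hNφ x).2 (hXN x hx))
  have hone : s₂ 1 = 1 := mul_inv_cancel _
  -- The set `Z'` consists of the remainders of the points of `X`. It lies in `Δ`, so being distinct
  -- modulo `H` and modulo `H ⊓ Δ` is the same there.
  refine ⟨A.image s₂, X.image fun x => (s₂ (φ x))⁻¹ * x, c₀ * δ⁻¹, ?_, ?_, ?_, ?_, ?_, ?_, ?_, ?_,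
    ?_, ?_, ?_, ?_⟩
  · intro x hx
    obtain ⟨u, hu, rfl⟩ := Finset.mem_image.1 hx
    rw [← hNφ, hs₂ u hu]
    exact (hmemA u).1 hu
  · exact Finset.mem_image.2 ⟨1, h1A, hone⟩
  · intro n hn
    have hnA : φ n ∈ A := (hmemA _).2 ((hNφ n).2 hn)
    exact ⟨_, Finset.mem_image_of_mem _ hnA, (hφeq _ _).1 (hs₂ _ hnA)⟩
  · intro x hx y hy h
    obtain ⟨u, hu, rfl⟩ := Finset.mem_image.1 hx
    obtain ⟨v, hv, rfl⟩ := Finset.mem_image.1 hy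
    rw [← hφeq, hs₂ u hu, hs₂ v hv] at h
    rw [h]
  · intro w hw
    obtain ⟨x, hx, rfl⟩ := Finset.mem_image.1 hw
    exact (hφeq _ _).1 (hs₂ _ (hXA x hx))
  · refine Finset.mem_image.2 ⟨1, h1X, ?_⟩
    simp [hone]
  · intro w hw w' hw' hww
    have hwΔ : w⁻¹ * w' ∈ Δ := by
      obtain ⟨x, hx, rfl⟩ := Finset.mem_image.1 hw
      obtain ⟨x', hx', rfl⟩ := Finset.mem_image.1 hw'
      exact Δ.mul_mem (Δ.inv_mem ((hφeq _ _).1 (hs₂ _ (hXA x hx))))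
        ((hφeq _ _).1 (hs₂ _ (hXA x' hx')))
    obtain ⟨x, hx, rfl⟩ := Finset.mem_image.1 hw
    obtain ⟨x', hx', rfl⟩ := Finset.mem_image.1 hw'
    have hxx : x = x' := by
      refine hdX x hx x' hx' ?_
      rw [← hs₁X x hx, ← hs₁X x' hx']
      have : ((s₁ (φ x))⁻¹ * x)⁻¹ * ((s₁ (φ x'))⁻¹ * x') =
          ((s₂ (φ x))⁻¹ * x)⁻¹ * ((s₂ (φ x'))⁻¹ * x') := by
        simp [s₂, mul_assoc]
      rw [this]
      exact ⟨hww, hwΔ⟩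
    rw [hxx]
  · intro x hx
    exact Finset.mem_mul.2 ⟨_, Finset.mem_image_of_mem _ (hXA x hx), _,
      Finset.mem_image_of_mem _ hx, mul_inv_cancel_left _ _⟩
  · exact N.mul_mem hc₀N (N.inv_mem (hΔN hδΔ))
  · intro z hz
    refine Finset.mem_image.2 ⟨φ (z * c₀), (hmemA _).2 ((hNφ _).2 (N.mul_mem (hZN z hz) hc₀N)), ?_⟩
    simp only [s₂, hs₁Z z hz, mul_assoc]
  · rw [hDcard, hAcard]
    exact hm
  · have h1 := card_filter_image_section_le φ (E := E) (A := A) (s := s₂) fun t ht u hu => by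
      rw [hmemA] at hu ⊢
      exact mul_mem ((hNφ t).2 (hEN t ht)) hu
    rw [hbad₂] at h1
    have h2 : (X.image φ ∪ Zc.image φ).card ≤ X.card + Z.card :=
      (Finset.card_union_le _ _).trans (Nat.add_le_add Finset.card_image_le
        (Finset.card_image_le.trans Finset.card_image_le))
    have h3 : ((badPairs φ E A s₁).card : ℝ) ≤ (badPairs φ E A s).card +
        2 * (E.card * (X.card + Z.card)) := by
      exact_mod_cast hbad₁.trans (by gcongr)
    rw [hDcard]
    calc (((A.image s₂).filter fun d => ∃ t ∈ E, t * d ∉ A.image s₂).card : ℝ)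
        ≤ (badPairs φ E A s₁).card := by exact_mod_cast h1
      _ ≤ 2 * E.card * η * A.card + 2 * (E.card * (X.card + Z.card)) := by linarith
      _ = _ := by ring

end Groups

end PropID

namespace PropID

/-! ### Levels and their refinement -/

section Levels

variable {Γ : Type*} [Group Γ]

/-- A transversal `F` of a finite index normal subgroup `N`, and a finite set `Z ⊆ N`, distinct
modulo `H`, such that `H ⊆ F Z (H ∩ N)`. -/
structure Level (H : Subgroup Γ) where
  N : Subgroup Γ
  normal : N.Normal
  finiteIndex : N.FiniteIndex
  F : Finset Γ
  Z : Finset Γ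
  one_mem_F : 1 ∈ F
  one_mem_Z : 1 ∈ Z
  Z_subset : ∀ z ∈ Z, z ∈ N
  exists_mem_F : ∀ g, ∃ f ∈ F, f⁻¹ * g ∈ N
  F_inj : ∀ f ∈ F, ∀ f' ∈ F, f⁻¹ * f' ∈ N → f = f'
  Z_inj : ∀ z ∈ Z, ∀ z' ∈ Z, z⁻¹ * z' ∈ H → z = z'
  covers : ∀ h ∈ H, ∃ f ∈ F, ∃ z ∈ Z, ∃ l ∈ H ⊓ N, h = f * z * l

namespace Level

variable {H : Subgroup Γ}

theorem eq_and_eq_of_mul_eq (ℓ : Level H) {f f' w w' : Γ} (hf : f ∈ ℓ.F) (hf' : f' ∈ ℓ.F)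
    (hw : w ∈ ℓ.N) (hw' : w' ∈ ℓ.N) (h : f * w = f' * w') : f = f' ∧ w = w' := by
  have hff : f = f' := by
    refine ℓ.F_inj f hf f' hf' ?_
    have : f⁻¹ * f' = w * w'⁻¹ := by
      rw [eq_mul_inv_iff_mul_eq, mul_assoc, ← h, inv_mul_cancel_left]
    rw [this]
    exact ℓ.N.mul_mem hw (ℓ.N.inv_mem hw')
  subst hff
  exact ⟨rfl, mul_left_cancel h⟩

theorem card_F (ℓ : Level H) : ℓ.F.card = ℓ.N.index := by
  rw [Subgroup.index_eq_card, ← Fintype.card_coe, ← Nat.card_eq_fintype_card]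
  refine Nat.card_eq_of_bijective (fun f : ℓ.F => ((f : Γ) : Γ ⧸ ℓ.N)) ⟨?_, ?_⟩
  · intro f f' h
    exact Subtype.ext (ℓ.F_inj f f.2 f' f'.2 (QuotientGroup.eq.1 h))
  · intro u
    induction u using QuotientGroup.induction_on with
    | H g =>
      obtain ⟨f, hf, hfg⟩ := ℓ.exists_mem_F g
      exact ⟨⟨f, hf⟩, QuotientGroup.eq.2 hfg⟩

variable (H) in
/-- The level given by the whole group. -/
def top : Level H where
  N := ⊤
  normal := inferInstance
  finiteIndex := inferInstance
  F := {1}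
  Z := {1}
  one_mem_F := Finset.mem_singleton_self _
  one_mem_Z := Finset.mem_singleton_self _
  Z_subset := by simp
  exists_mem_F := by simp
  F_inj := by simp
  Z_inj := by simp
  covers := fun h hh => ⟨1, by simp, 1, by simp, h, by simpa using hh, by simp⟩

/-- By normality `F c` is again injective modulo `N`, so it contains at most one point of `H` for
each element of the image of `H`. -/
theorem ncard_inter_rightTranslate_le (ℓ : Level H) (c : Γ) (hN : ℓ.N.Normal)
    (hf : ℓ.N.FiniteIndex) :
    ((H : Set Γ) ∩ (rightTranslate ℓ.F c : Finset Γ)).ncard ≤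
      Nat.card (H.map (QuotientGroup.mk' ℓ.N)) := by
  rw [← Nat.card_coe_set_eq]
  refine Nat.card_le_card_of_injective
    (fun x => ⟨QuotientGroup.mk' ℓ.N x.1, x.1, x.2.1, rfl⟩) ?_
  rintro ⟨x, hxH, hx⟩ ⟨y, hyH, hy⟩ heq
  have h : x⁻¹ * y ∈ ℓ.N := QuotientGroup.eq.1 (congrArg Subtype.val heq)
  have h' := ℓ.F_inj _ (mem_rightTranslate.1 hx) _ (mem_rightTranslate.1 hy) (by
    have := hN.conj_mem _ h c
    simpa [mul_assoc] using this)
  exact Subtype.ext (mul_right_cancel h')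

/-- Bookkeeping for the invariance of `D`, with `e = |E'|`, `x = |X| + |Z|`, `d = |D|` and `p` the
order of the image of `H`. Each of the two terms is at most `ε d / 2`. -/
theorem two_mul_mul_add_le {ε e x d m b p : ℝ} (hε : 0 < ε) (he : 0 ≤ e) (hp : 0 ≤ p) (hd : 0 ≤ d)
    (h1 : 4 * e * m / ε ≤ b) (h2 : x ≤ m * p) (h3 : b * p ≤ d) :
    2 * e * (ε / (4 * (e + 1)) * d + x) ≤ ε * d := by
  rw [div_le_iff₀ hε] at h1
  have h5 : 4 * e * x ≤ ε * d := by
    calc 4 * e * x ≤ 4 * e * (m * p) := by gcongr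
      _ = 4 * e * m * p := by ring
      _ ≤ b * ε * p := by gcongr
      _ = ε * (b * p) := by ring
      _ ≤ ε * d := by gcongr
  have h6 : 4 * e * (ε / (4 * (e + 1))) ≤ ε := by
    rw [← mul_div_assoc, div_le_iff₀ (by positivity)]
    nlinarith
  have h7 : 4 * e * (ε / (4 * (e + 1))) * d ≤ ε * d := by gcongr
  linarith

/-- `ℓ'` refines `ℓ`: its transversal is `F D`, where `D` contains `Z c` and `D Z'` contains `Z J`
for a transversal `J` of `H ∩ N'` in `H ∩ N`. -/
structure Refines [DecidableEq Γ] (ℓ ℓ' : Level H) (D J : Finset Γ) (c : Γ) : Prop where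
  le : ℓ'.N ≤ ℓ.N
  F_eq : ℓ'.F = ℓ.F * D
  D_subset : ∀ d ∈ D, d ∈ ℓ.N
  J_subset : ∀ j ∈ J, j ∈ H ⊓ ℓ.N
  one_mem_J : 1 ∈ J
  exists_mem_J : ∀ h ∈ H ⊓ ℓ.N, ∃ j ∈ J, j⁻¹ * h ∈ ℓ'.N
  ZJ_subset : ℓ.Z * J ⊆ D * ℓ'.Z
  exists_notMem_ZJ : ∃ y ∈ D * ℓ'.Z, y ∉ ℓ.Z * J
  c_mem : c ∈ ℓ.N
  Zc_subset : ℓ.Z * {c} ⊆ D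
  exists_notMem_Zc : ∃ x ∈ D, x ∉ ℓ.Z * {c}

variable [DecidableEq Γ]

/-- The product of a transversal of `N` and an almost invariant transversal of `N / Δ` is almost
invariant. -/
theorem isInvariant_mul (ℓ : Level H) {D E E' : Finset Γ} {ε : ℝ}
    (hDN : ∀ d ∈ D, d ∈ ℓ.N) (hE' : ∀ t ∈ E, ∀ f ∈ ℓ.F, ∃ f' ∈ ℓ.F, f'⁻¹ * (t * f) ∈ E')
    (hD : ((D.filter fun d => ∃ t ∈ E', t * d ∉ D).card : ℝ) ≤ ε * D.card) :
    IsInvariant E ε (ℓ.F * D) := by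
  rw [isInvariant_iff]
  have hcard : (ℓ.F * D).card = ℓ.F.card * D.card := by
    refine Finset.card_mul_iff.2 ?_
    rintro ⟨f, d⟩ hp ⟨f', d'⟩ hp' heq
    obtain ⟨hf, hd⟩ := Set.mem_prod.1 hp
    obtain ⟨hf', hd'⟩ := Set.mem_prod.1 hp'
    obtain ⟨h1, h2⟩ := ℓ.eq_and_eq_of_mul_eq hf hf' (hDN d hd) (hDN d' hd') heq
    exact Prod.ext h1 h2
  have hsub : ((ℓ.F * D).filter fun s => ∃ t ∈ E, t * s ∉ ℓ.F * D) ⊆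
      ℓ.F * (D.filter fun d => ∃ t ∈ E', t * d ∉ D) := by
    intro s hs
    obtain ⟨hs, t, ht, hts⟩ := Finset.mem_filter.1 hs
    obtain ⟨f, hf, d, hd, rfl⟩ := Finset.mem_mul.1 hs
    obtain ⟨f', hf', hmem⟩ := hE' t ht f hf
    refine Finset.mul_mem_mul hf (Finset.mem_filter.2 ⟨hd, _, hmem, fun h => hts ?_⟩)
    have : t * (f * d) = f' * (f'⁻¹ * (t * f) * d) := by simp [mul_assoc]
    rw [this]
    exact Finset.mul_mem_mul hf' h
  calc (((ℓ.F * D).filter fun s => ∃ t ∈ E, t * s ∉ ℓ.F * D).card : ℝ)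
      ≤ ℓ.F.card * (D.filter fun d => ∃ t ∈ E', t * d ∉ D).card := by
        exact_mod_cast (Finset.card_le_card hsub).trans Finset.card_mul_le
    _ ≤ ℓ.F.card * (ε * D.card) := by gcongr
    _ = ε * (ℓ.F * D).card := by rw [hcard]; push_cast; ring

/-- The level `(Δ, F D, Z')` refining a given one. -/
def refine (ℓ : Level H) (Δ : Subgroup Γ) (hn : Δ.Normal) (hf : Δ.FiniteIndex) (hΔ : Δ ≤ ℓ.N)
    (D Z' J : Finset Γ) (hDN : ∀ d ∈ D, d ∈ ℓ.N) (h1D : 1 ∈ D)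
    (hD : ∀ n ∈ ℓ.N, ∃ d ∈ D, d⁻¹ * n ∈ Δ) (hDinj : ∀ d ∈ D, ∀ d' ∈ D, d⁻¹ * d' ∈ Δ → d = d')
    (hZ'Δ : ∀ w ∈ Z', w ∈ Δ) (h1Z' : 1 ∈ Z')
    (hZ' : ∀ w ∈ Z', ∀ w' ∈ Z', w⁻¹ * w' ∈ H → w = w') (hJH : ∀ j ∈ J, j ∈ H)
    (hJ : ∀ h ∈ H ⊓ ℓ.N, ∃ j ∈ J, j⁻¹ * h ∈ Δ) (hZJ : ℓ.Z * J ⊆ D * Z') : Level H where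
  N := Δ
  normal := hn
  finiteIndex := hf
  F := ℓ.F * D
  Z := Z'
  one_mem_F := by simpa using Finset.mul_mem_mul ℓ.one_mem_F h1D
  one_mem_Z := h1Z'
  Z_subset := hZ'Δ
  exists_mem_F := by
    intro g
    obtain ⟨f, hf, hfg⟩ := ℓ.exists_mem_F g
    obtain ⟨d, hd, hdg⟩ := hD _ hfg
    exact ⟨f * d, Finset.mul_mem_mul hf hd, by simpa [mul_assoc] using hdg⟩
  F_inj := by
    intro x hx x' hx' hxx
    obtain ⟨f, hf, d, hd, rfl⟩ := Finset.mem_mul.1 hx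
    obtain ⟨f', hf', d', hd', rfl⟩ := Finset.mem_mul.1 hx'
    have hff : f = f' := by
      refine ℓ.F_inj f hf f' hf' ?_
      have := ℓ.N.mul_mem (ℓ.N.mul_mem (hDN d hd) (hΔ hxx)) (ℓ.N.inv_mem (hDN d' hd'))
      simpa [mul_assoc] using this
    subst hff
    rw [hDinj d hd d' hd' (by simpa [mul_assoc] using hxx)]
  Z_inj := hZ'
  covers := by
    intro h hh
    obtain ⟨f, hf, z, hz, l, hl, rfl⟩ := ℓ.covers h hh
    obtain ⟨j, hj, hjl⟩ := hJ l hl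
    obtain ⟨d, hd, w, hw, hdw⟩ := Finset.mem_mul.1 (hZJ (Finset.mul_mem_mul hz hj))
    refine ⟨f * d, Finset.mul_mem_mul hf hd, w, hw, j⁻¹ * l,
      ⟨H.mul_mem (H.inv_mem (hJH j hj)) hl.1, hjl⟩, ?_⟩
    rw [mul_assoc f d w, hdw]
    simp [mul_assoc]

-- The order of choices matters: `S`, `K'`, `L₀` and the conjugators `R` depend only on the given
-- level and the parameters, so `Δ` can be taken to separate them all. Only then are `J`, `X` and
-- `D` chosen.
set_option maxHeartbeats 1000000 in
theorem exists_refines [Group.ResiduallyFinite Γ] (hΓ : IsAmenable Γ) {a : Γ}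
    (ha : (conjugatesOf a).Infinite) (hHa : H = Subgroup.zpowers a) (ℓ : Level H)
    (K E : Finset Γ) {ε : ℝ} (hε : 0 < ε) (B : ℕ) :
    ∃ (ℓ' : Level H) (D J : Finset Γ) (c : Γ), ℓ.Refines ℓ' D J c ∧
      K ⊆ ℓ'.F * ℓ'.Z ∧ IsInvariant E ε ℓ'.F ∧ B ≤ ℓ'.F.card ∧
      ∀ g, B * ((H : Set Γ) ∩ (rightTranslate ℓ'.F g : Finset Γ)).ncard ≤
        ℓ'.F.card := by
  classical
  have hH : ¬ H.FiniteIndex := hHa ▸ not_finiteIndex_zpowers ha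
  have hNn := ℓ.normal
  have hNf := ℓ.finiteIndex
  choose r hrF hrN using ℓ.exists_mem_F
  -- the elements of `N` that have to be almost preserved
  set E₀ : Finset Γ := (E ×ˢ ℓ.F).image fun p => (r (p.1 * p.2))⁻¹ * (p.1 * p.2) with hE₀
  set E' : Finset Γ := E₀ ∪ E₀.image (·⁻¹) with hE'def
  have hE₀N : ∀ t ∈ E₀, t ∈ ℓ.N := by
    intro t ht
    obtain ⟨p, -, rfl⟩ := Finset.mem_image.1 ht
    exact hrN _
  have hE'N : ∀ t ∈ E', t ∈ ℓ.N := by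
    intro t ht
    rcases Finset.mem_union.1 ht with h | h
    · exact hE₀N t h
    · obtain ⟨s, hs, rfl⟩ := Finset.mem_image.1 h
      exact ℓ.N.inv_mem (hE₀N s hs)
  have hE'inv : ∀ t ∈ E', t⁻¹ ∈ E' := by
    intro t ht
    rcases Finset.mem_union.1 ht with h | h
    · exact Finset.mem_union_right _ (Finset.mem_image_of_mem _ h)
    · obtain ⟨s, hs, rfl⟩ := Finset.mem_image.1 h
      rw [inv_inv]
      exact Finset.mem_union_left _ hs
  obtain ⟨S, hSne, hS⟩ := hΓ E' (ε / (4 * (E'.card + 1))) (by positivity)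
  set K' : Finset Γ := insert 1 (K.image fun k => (r k)⁻¹ * k) with hK'
  have hK'N : ∀ k ∈ K', k ∈ ℓ.N := by
    intro k hk
    rcases Finset.mem_insert.1 hk with rfl | hk
    · exact one_mem _
    · obtain ⟨k, -, rfl⟩ := Finset.mem_image.1 hk
      exact hrN k
  -- A point of `K'` in `z H` could collide modulo `H ⊓ Δ` with a point of `Z J`. The elements `z⁻¹
  -- * k` are therefore forced into `J`, so that such a point belongs to `Z J`.
  set L₀ : Finset Γ := insert 1 ((ℓ.Z ×ˢ K').image (fun p => p.1⁻¹ * p.2) |>.filter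
    fun h => h ∈ H ⊓ ℓ.N) with hL₀
  have hL₀HN : ∀ l ∈ L₀, l ∈ H ⊓ ℓ.N := by
    intro l hl
    rcases Finset.mem_insert.1 hl with rfl | hl
    · exact one_mem _
    · exact (Finset.mem_filter.1 hl).2
  -- the required indices
  set m₀ := 2 * ℓ.Z.card + K'.card with hm₀
  -- The first two summands leave room for a translate of `Z` away from `X` and for regular tiles,
  -- the third makes the changed values negligible for invariance, and `B` serves the size and
  -- thinness bounds.
  set B₁ := ℓ.Z.card * m₀ + 1 + ⌈4 * E'.card * m₀ / ε⌉₊ + B with hB₁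
  obtain ⟨R, hRcard, hR⟩ := exists_conjugators ha (ℓ.F.card * B₁)
  let diff : Finset Γ → Finset Γ := fun T => (T ×ˢ T).image fun p => p.1⁻¹ * p.2
  obtain ⟨Δ, hΔN, hΔn, hΔf, hΔ⟩ := exists_normal_avoiding ℓ.N
    (diff S ∪ diff K' ∪ diff L₀ ∪ diff ℓ.Z ∪ diff (R.image fun r => r * a * r⁻¹))
  have hdiff : ∀ T : Finset Γ, diff T ⊆ diff S ∪ diff K' ∪ diff L₀ ∪ diff ℓ.Z ∪
      diff (R.image fun r => r * a * r⁻¹) → ∀ x ∈ T, ∀ y ∈ T, x⁻¹ * y ∈ Δ → x = y :=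
    fun T hT x hx y hy hxy => (inv_mul_eq_one.1 (hΔ _ (hT (Finset.mem_image.2
      ⟨(x, y), Finset.mem_product.2 ⟨hx, hy⟩, rfl⟩)) hxy))
  have hSΔ := hdiff S fun x hx => by simp only [Finset.mem_union]; tauto
  have hK'Δ := hdiff K' fun x hx => by simp only [Finset.mem_union]; tauto
  have hL₀Δ := hdiff L₀ fun x hx => by simp only [Finset.mem_union]; tauto
  have hZΔ := hdiff ℓ.Z fun x hx => by simp only [Finset.mem_union]; tauto
  have hRΔ := hdiff (R.image fun r => r * a * r⁻¹) fun x hx => by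
    simp only [Finset.mem_union]; tauto
  set φ := QuotientGroup.mk' Δ with hφ
  have hφeq : ∀ g g' : Γ, φ g = φ g' ↔ g⁻¹ * g' ∈ Δ := fun g g' => QuotientGroup.eq
  have hindex : R.card * Nat.card (H.map φ) ≤ Nat.card (Γ ⧸ Δ) :=
    hHa ▸ card_mul_card_map_zpowers_le φ fun s hs s' hs' h => hR s hs s' hs' (hRΔ _
      (Finset.mem_image_of_mem _ hs) _ (Finset.mem_image_of_mem _ hs') ((hφeq _ _).1 h))
  rw [hRcard] at hindex
  have hFA : Nat.card (Γ ⧸ Δ) ≤ ℓ.F.card * Nat.card (ℓ.N.map φ) := by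
    rw [← Fintype.card_coe ℓ.F, ← Nat.card_eq_fintype_card, ← Nat.card_prod]
    refine Nat.card_le_card_of_surjective (fun p => φ p.1 * p.2) fun u => ?_
    obtain ⟨g, rfl⟩ := QuotientGroup.mk'_surjective Δ u
    exact ⟨(⟨r g, hrF g⟩, ⟨φ ((r g)⁻¹ * g), _, hrN g, rfl⟩), by simp [← hφ]⟩
  have hHpos : 0 < Nat.card (H.map φ) := Nat.card_pos
  -- The factor `|F|` in the number of conjugators cancels against the index of `N`.
  have hm : B₁ * Nat.card (H.map φ) ≤ Nat.card (ℓ.N.map φ) := by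
    refine Nat.le_of_mul_le_mul_left (c := ℓ.F.card) ?_ (Finset.card_pos.2 ⟨1, ℓ.one_mem_F⟩)
    rw [← mul_assoc]
    exact hindex.trans hFA
  obtain ⟨J, hL₀J, hJHN, hJ, hJinj, hJcard⟩ := exists_transversal_extending φ (H ⊓ ℓ.N) L₀ hL₀HN
    fun x hx y hy h => hL₀Δ x hx y hy ((hφeq x y).1 h)
  replace hJcard : J.card ≤ Nat.card (H.map φ) :=
    hJcard.trans (Nat.card_le_card_of_injective _
      (Subgroup.inclusion_injective (Subgroup.map_mono inf_le_left)))
  have h1J : 1 ∈ J := hL₀J (Finset.mem_insert_self _ _)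
  -- the points that `D Z'` has to contain
  set K'' := K'.filter fun k => ¬ ∃ z ∈ ℓ.Z, z⁻¹ * k ∈ H with hK''
  set X := ℓ.Z * J ∪ K'' with hX
  have hZJinj : ∀ z ∈ ℓ.Z, ∀ j ∈ J, ∀ z' ∈ ℓ.Z, ∀ g, (z * j)⁻¹ * (z' * g) ∈ H → g ∈ H →
      z = z' := by
    intro z hz j hj z' hz' g hmem hg
    refine ℓ.Z_inj z hz z' hz' ?_
    have := H.mul_mem (H.mul_mem (hJHN j hj).1 hmem) (H.inv_mem hg)
    simpa [mul_assoc] using this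
  have hXinj : ∀ x ∈ X, ∀ x' ∈ X, x⁻¹ * x' ∈ H ⊓ Δ → x = x' := by
    have hZK : ∀ z ∈ ℓ.Z, ∀ j ∈ J, ∀ k ∈ K'', (z * j)⁻¹ * k ∈ H → False := by
      intro z hz j hj k hk hmem
      refine (Finset.mem_filter.1 hk).2 ⟨z, hz, ?_⟩
      have := H.mul_mem (hJHN j hj).1 hmem
      simpa [mul_assoc] using this
    intro x hx x' hx' hxx
    rcases Finset.mem_union.1 hx with hx | hx <;> rcases Finset.mem_union.1 hx' with hx' | hx'
    · obtain ⟨z, hz, j, hj, rfl⟩ := Finset.mem_mul.1 hx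
      obtain ⟨z', hz', j', hj', rfl⟩ := Finset.mem_mul.1 hx'
      obtain rfl := hZJinj z hz j hj z' hz' j' hxx.1 (hJHN j' hj').1
      rw [hJinj hj hj' ((hφeq _ _).2 (by simpa [mul_assoc] using hxx.2))]
    · obtain ⟨z, hz, j, hj, rfl⟩ := Finset.mem_mul.1 hx
      exact (hZK z hz j hj x' hx' hxx.1).elim
    · obtain ⟨z, hz, j, hj, rfl⟩ := Finset.mem_mul.1 hx'
      refine (hZK z hz j hj x hx ?_).elim
      simpa [mul_assoc] using H.inv_mem hxx.1
    · exact hK'Δ x (Finset.mem_filter.1 hx).1 x' (Finset.mem_filter.1 hx').1 hxx.2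
  have hK'X : K' ⊆ X := by
    intro k hk
    by_cases h : ∃ z ∈ ℓ.Z, z⁻¹ * k ∈ H
    · obtain ⟨z, hz, hzk⟩ := h
      refine Finset.mem_union_left _ (Finset.mem_mul.2 ⟨z, hz, z⁻¹ * k, hL₀J ?_, by simp⟩)
      refine Finset.mem_insert_of_mem (Finset.mem_filter.2 ⟨Finset.mem_image.2
        ⟨(z, k), Finset.mem_product.2 ⟨hz, hk⟩, rfl⟩, hzk, ?_⟩)
      exact ℓ.N.mul_mem (ℓ.N.inv_mem (ℓ.Z_subset z hz)) (hK'N k hk)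
    · exact Finset.mem_union_right _ (Finset.mem_filter.2 ⟨hk, h⟩)
  have hXN : ∀ x ∈ X, x ∈ ℓ.N := by
    intro x hx
    rcases Finset.mem_union.1 hx with hx | hx
    · obtain ⟨z, hz, j, hj, rfl⟩ := Finset.mem_mul.1 hx
      exact ℓ.N.mul_mem (ℓ.Z_subset z hz) (hJHN j hj).2
    · exact hK'N x (Finset.mem_filter.1 hx).1
  have hXcard : X.card + ℓ.Z.card ≤ m₀ * Nat.card (H.map φ) := by
    have h1 : X.card ≤ ℓ.Z.card * J.card + K'.card :=
      (Finset.card_union_le _ _).trans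
        (Nat.add_le_add Finset.card_mul_le (Finset.card_filter_le _ _))
    rw [hm₀]
    nlinarith [Nat.mul_le_mul_left ℓ.Z.card hJcard]
  have hB₁le : ℓ.Z.card * (X.card + ℓ.Z.card) < B₁ * Nat.card (H.map φ) := by
    calc ℓ.Z.card * (X.card + ℓ.Z.card)
        ≤ ℓ.Z.card * (m₀ * Nat.card (H.map φ)) := Nat.mul_le_mul_left _ hXcard
      _ < (ℓ.Z.card * m₀ + 1) * Nat.card (H.map φ) := by rw [← mul_assoc, add_mul]; omega
      _ ≤ B₁ * Nat.card (H.map φ) := Nat.mul_le_mul_right _ (by rw [hB₁]; omega)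
  obtain ⟨D, Z', c, hDN, h1D, hD, hDinj, hZ'Δ, h1Z', hZ', hXD, hcN, hZc, hmD, hDinv⟩ :=
    exists_transversal (S := S) (E := E') hH hΔN hXN (hK'X (Finset.mem_insert_self _ _)) hXinj
      ℓ.Z_subset hZΔ hm ((Nat.mul_le_mul_left _ (Nat.le_add_right _ _)).trans_lt hB₁le) hE'N
      hE'inv hSne hSΔ hS
  have hZJD : ℓ.Z * J ⊆ D * Z' := Finset.subset_union_left.trans hXD
  have hZpos : 0 < ℓ.Z.card := Finset.card_pos.2 ⟨1, ℓ.one_mem_Z⟩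
  have hXZD : X.card + ℓ.Z.card < D.card :=
    ((Nat.le_mul_of_pos_left _ hZpos).trans_lt hB₁le).trans_le hmD
  let ℓ' : Level H := ℓ.refine Δ hΔn hΔf hΔN D Z' J hDN h1D hD hDinj hZ'Δ h1Z' hZ'
    (fun j hj => (hJHN j hj).1) (fun h hh => by
      obtain ⟨j, hj, hjh⟩ := hJ h hh
      exact ⟨j, hj, (hφeq _ _).1 hjh⟩) hZJD
  have hℓ'card : ℓ'.F.card = Nat.card (Γ ⧸ Δ) := ℓ'.card_F.trans (Subgroup.index_eq_card _)
  have hBle : B * Nat.card (H.map φ) ≤ ℓ'.F.card := by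
    rw [hℓ'card]
    refine le_trans (Nat.mul_le_mul_right _ ?_) hindex
    have : B ≤ B₁ := by rw [hB₁]; omega
    exact this.trans (Nat.le_mul_of_pos_left _ (Finset.card_pos.2 ⟨1, ℓ.one_mem_F⟩))
  refine ⟨ℓ', D, J, c, ⟨hΔN, rfl, hDN, hJHN, h1J, ?_, hZJD, ?_, hcN, ?_, ?_⟩, ?_, ?_, ?_, ?_⟩
  · intro h hh
    obtain ⟨j, hj, hjh⟩ := hJ h hh
    exact ⟨j, hj, (hφeq _ _).1 hjh⟩
  · refine Finset.exists_mem_notMem_of_card_lt_card ?_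
    have h1 : (ℓ.Z * J).card ≤ X.card := Finset.card_le_card Finset.subset_union_left
    have h2 : D.card ≤ (D * Z').card := Finset.card_le_card fun d hd =>
      Finset.mem_mul.2 ⟨d, hd, 1, h1Z', mul_one d⟩
    change (ℓ.Z * J).card < (D * Z').card
    omega
  · intro x hx
    obtain ⟨z, hz, y, hy, rfl⟩ := Finset.mem_mul.1 hx
    rw [Finset.mem_singleton.1 hy]
    exact hZc z hz
  · refine Finset.exists_mem_notMem_of_card_lt_card ?_
    rw [Finset.card_mul_singleton]
    omega
  · intro k hk
    have h1 : (r k)⁻¹ * k ∈ D * Z' := hXD (hK'X (Finset.mem_insert_of_mem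
      (Finset.mem_image_of_mem _ hk)))
    change k ∈ ℓ.F * D * Z'
    rw [mul_assoc]
    exact Finset.mem_mul.2 ⟨r k, hrF k, _, h1, mul_inv_cancel_left _ _⟩
  · refine ℓ.isInvariant_mul hDN (E' := E') (fun t ht f hf => ⟨r (t * f), hrF _, ?_⟩) ?_
    · exact Finset.mem_union_left _ (Finset.mem_image.2
        ⟨(t, f), Finset.mem_product.2 ⟨ht, hf⟩, rfl⟩)
    · refine hDinv.trans ?_
      have h1 : 4 * E'.card * m₀ / ε ≤ (B₁ : ℝ) := by
        refine (Nat.le_ceil _).trans ?_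
        rw [hB₁]
        exact_mod_cast by omega
      exact two_mul_mul_add_le hε (Nat.cast_nonneg _) (Nat.cast_nonneg _) (Nat.cast_nonneg _)
        h1 (by exact_mod_cast hXcard) (by exact_mod_cast hmD)
  · exact (Nat.le_mul_of_pos_right _ hHpos).trans hBle
  · intro g
    exact (Nat.mul_le_mul_left _ (ℓ'.ncard_inter_rightTranslate_le g hΔn hΔf)).trans hBle

end Level

end Levels

end PropID

namespace PropID

/-! ### From refinements to property ID -/

section Assembly

variable {Γ : Type*} [Group Γ] [DecidableEq Γ] {H : Subgroup Γ}

namespace Level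

/-- The special shape `F Z` and the regular shape `F`. -/
def shape (ℓ : Level H) : Bool → Finset Γ
  | true => ℓ.F * ℓ.Z
  | false => ℓ.F

/-- The partition of `F W` into the special tiles `F Z j` for `j ∈ J` and regular tiles `F y`. -/
def rule (ℓ : Level H) (W J : Finset Γ) : Finset (Bool × Γ) :=
  J.image (fun j => (true, j)) ∪ (W \ (ℓ.Z * J)).image fun y => (false, y)

theorem mem_rule {ℓ : Level H} {W J : Finset Γ} {q : Bool × Γ} :
    q ∈ ℓ.rule W J ↔ (∃ j ∈ J, (true, j) = q) ∨ ∃ y ∈ W \ (ℓ.Z * J), (false, y) = q := by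
  simp only [rule, Finset.mem_union, Finset.mem_image]

theorem one_mem_shape (ℓ : Level H) (b : Bool) : 1 ∈ ℓ.shape b := by
  cases b
  · exact ℓ.one_mem_F
  · exact Finset.mem_mul.2 ⟨1, ℓ.one_mem_F, 1, ℓ.one_mem_Z, mul_one 1⟩

theorem rightTranslate_eq_mul (S : Finset Γ) (c : Γ) : rightTranslate S c = S * {c} := by
  ext x
  rw [mem_rightTranslate, Finset.mem_mul]
  constructor
  · exact fun h => ⟨_, h, c, Finset.mem_singleton_self c, by simp⟩
  · rintro ⟨s, hs, c', hc, rfl⟩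
    rw [Finset.mem_singleton.1 hc]
    simpa using hs

theorem rule_subset (ℓ : Level H) {W J : Finset Γ} (hJW : ℓ.Z * J ⊆ W) :
    ∀ q ∈ ℓ.rule W J, rightTranslate (ℓ.shape q.1) q.2 ⊆ ℓ.F * W := by
  intro q hq
  rw [rightTranslate_eq_mul]
  rcases mem_rule.1 hq with ⟨j, hj, rfl⟩ | ⟨y, hy, rfl⟩
  · change ℓ.F * ℓ.Z * {j} ⊆ ℓ.F * W
    rw [mul_assoc]
    exact Finset.mul_subset_mul_left
      ((Finset.mul_subset_mul_left (Finset.singleton_subset_iff.2 hj)).trans hJW)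
  · change ℓ.F * {y} ⊆ ℓ.F * W
    exact Finset.mul_subset_mul_left (Finset.singleton_subset_iff.2 (Finset.mem_sdiff.1 hy).1)

/-- The factor `w ∈ N` of `f * w` is determined. If `w = z * j = z' * j'`, then `z⁻¹ * z' = j * j'⁻¹
∈ H`, and injectivity of `Z` modulo `H` fixes the special tile. The hypothesis on `J` allows both
subsets of `H` and a singleton. -/
theorem rule_unique (ℓ : Level H) {W J : Finset Γ} (hJW : ℓ.Z * J ⊆ W) (hWN : ∀ w ∈ W, w ∈ ℓ.N)
    (hJ : ∀ j ∈ J, ∀ j' ∈ J, j * j'⁻¹ ∈ H) :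
    ∀ s ∈ ℓ.F * W, ∃! q, q ∈ ℓ.rule W J ∧ s ∈ rightTranslate (ℓ.shape q.1) q.2 := by
  intro s hs
  obtain ⟨f, hf, w, hw, rfl⟩ := Finset.mem_mul.1 hs
  have key : ∀ q, q ∈ ℓ.rule W J → f * w ∈ rightTranslate (ℓ.shape q.1) q.2 →
      (∃ z ∈ ℓ.Z, ∃ j ∈ J, w = z * j ∧ q = (true, j)) ∨ (w ∉ ℓ.Z * J ∧ q = (false, w)) := by
    intro q hq hmem
    rw [rightTranslate_eq_mul] at hmem
    rcases mem_rule.1 hq with ⟨j, hj, rfl⟩ | ⟨y, hy, rfl⟩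
    · change f * w ∈ ℓ.F * ℓ.Z * {j} at hmem
      rw [mul_assoc] at hmem
      obtain ⟨f', hf', w', hw', heq⟩ := Finset.mem_mul.1 hmem
      obtain ⟨z, hz, j', hj', rfl⟩ := Finset.mem_mul.1 hw'
      obtain rfl := Finset.mem_singleton.1 hj'
      have h := ℓ.eq_and_eq_of_mul_eq hf' hf (hWN _ (hJW (Finset.mul_mem_mul hz hj))) (hWN w hw) heq
      exact Or.inl ⟨z, hz, j', hj, h.2.symm, rfl⟩
    · obtain ⟨f', hf', w', hw', heq⟩ := Finset.mem_mul.1 hmem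
      obtain rfl := Finset.mem_singleton.1 hw'
      obtain ⟨hyW, hyJ⟩ := Finset.mem_sdiff.1 hy
      have h := ℓ.eq_and_eq_of_mul_eq hf' hf (hWN _ hyW) (hWN w hw) heq
      rw [← h.2]
      exact Or.inr ⟨hyJ, rfl⟩
  by_cases hwJ : w ∈ ℓ.Z * J
  · obtain ⟨z, hz, j, hj, rfl⟩ := Finset.mem_mul.1 hwJ
    refine ⟨(true, j), ⟨mem_rule.2 (Or.inl ⟨j, hj, rfl⟩), ?_⟩, ?_⟩
    · rw [← mul_assoc]
      exact mul_mem_rightTranslate (Finset.mul_mem_mul hf hz)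
    · rintro q ⟨hq, hmem⟩
      rcases key q hq hmem with ⟨z', hz', j', hj', heq, rfl⟩ | ⟨h, -⟩
      · have hzz : z = z' := by
          refine ℓ.Z_inj z hz z' hz' ?_
          have : z⁻¹ * z' = j * j'⁻¹ := by
            rw [eq_mul_inv_iff_mul_eq, mul_assoc, ← heq, inv_mul_cancel_left]
          rw [this]
          exact hJ j hj j' hj'
        subst hzz
        rw [mul_left_cancel heq]
      · exact (h hwJ).elim
  · refine ⟨(false, w), ⟨mem_rule.2 (Or.inr ⟨w, Finset.mem_sdiff.2 ⟨hw, hwJ⟩, rfl⟩),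
      mul_mem_rightTranslate hf⟩, ?_⟩
    rintro q ⟨hq, hmem⟩
    rcases key q hq hmem with ⟨z, hz, j, hj, rfl, -⟩ | ⟨-, h⟩
    · exact (hwJ (Finset.mul_mem_mul hz hj)).elim
    · exact h

theorem card_shape_true (ℓ : Level H) : (ℓ.F * ℓ.Z).card = ℓ.F.card * ℓ.Z.card := by
  refine Finset.card_mul_iff.2 ?_
  rintro ⟨f, z⟩ hp ⟨f', z'⟩ hp' heq
  obtain ⟨hf, hz⟩ := Set.mem_prod.1 hp
  obtain ⟨hf', hz'⟩ := Set.mem_prod.1 hp'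
  obtain ⟨h1, h2⟩ := ℓ.eq_and_eq_of_mul_eq hf hf' (ℓ.Z_subset z hz) (ℓ.Z_subset z' hz') heq
  exact Prod.ext h1 h2

/-- The set `F Z` is a disjoint union of right translates of `F`, and left multiplication can move a
point out of the union only by moving it out of its translate. -/
theorem isInvariant_shape (ℓ : Level H) {E : Finset Γ} {ε : ℝ} (h : IsInvariant E ε ℓ.F)
    (b : Bool) : IsInvariant E ε (ℓ.shape b) := by
  cases b
  · exact h
  · change IsInvariant E ε (ℓ.F * ℓ.Z)
    rw [isInvariant_iff] at h ⊢
    have hsub : ((ℓ.F * ℓ.Z).filter fun s => ∃ t ∈ E, t * s ∉ ℓ.F * ℓ.Z) ⊆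
        (ℓ.F.filter fun s => ∃ t ∈ E, t * s ∉ ℓ.F) * ℓ.Z := by
      intro s hs
      obtain ⟨hs, t, ht, hts⟩ := Finset.mem_filter.1 hs
      obtain ⟨f, hf, z, hz, rfl⟩ := Finset.mem_mul.1 hs
      refine Finset.mul_mem_mul (Finset.mem_filter.2 ⟨hf, t, ht, fun h => hts ?_⟩) hz
      rw [← mul_assoc]
      exact Finset.mul_mem_mul h hz
    calc (((ℓ.F * ℓ.Z).filter fun s => ∃ t ∈ E, t * s ∉ ℓ.F * ℓ.Z).card : ℝ)
        ≤ (ℓ.F.filter fun s => ∃ t ∈ E, t * s ∉ ℓ.F).card * ℓ.Z.card := by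
          exact_mod_cast (Finset.card_le_card hsub).trans Finset.card_mul_le
      _ ≤ ε * ℓ.F.card * ℓ.Z.card := by gcongr
      _ = ε * (ℓ.F * ℓ.Z).card := by rw [card_shape_true]; push_cast; ring

theorem mul_ncard_inter_shape_le (ℓ : Level H) {B : ℕ}
    (h : ∀ g, B * ((H : Set Γ) ∩ (rightTranslate ℓ.F g : Finset Γ)).ncard ≤ ℓ.F.card)
    (b : Bool) (c : Γ) :
    B * ((H : Set Γ) ∩ (rightTranslate (ℓ.shape b) c : Finset Γ)).ncard ≤ (ℓ.shape b).card := by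
  cases b
  · exact h c
  · change B * ((H : Set Γ) ∩ (rightTranslate (ℓ.F * ℓ.Z) c : Finset Γ)).ncard ≤ (ℓ.F * ℓ.Z).card
    have hsub : (H : Set Γ) ∩ (rightTranslate (ℓ.F * ℓ.Z) c : Finset Γ) ⊆
        ⋃ z ∈ ℓ.Z, (H : Set Γ) ∩ (rightTranslate ℓ.F (z * c) : Finset Γ) := by
      rintro x ⟨hxH, hx⟩
      obtain ⟨f, hf, z, hz, hfz⟩ := Finset.mem_mul.1 (mem_rightTranslate.1 hx)
      refine Set.mem_iUnion₂.2 ⟨z, hz, hxH, mem_rightTranslate.2 ?_⟩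
      have : x * (z * c)⁻¹ = f := by
        rw [mul_inv_rev, ← mul_assoc, ← hfz, mul_inv_cancel_right]
      rwa [this]
    have hfin : (⋃ z ∈ ℓ.Z, (H : Set Γ) ∩ (rightTranslate ℓ.F (z * c) : Finset Γ)).Finite :=
      ℓ.Z.finite_toSet.biUnion fun z _ => (Finset.finite_toSet _).inter_of_right _
    calc B * ((H : Set Γ) ∩ (rightTranslate (ℓ.F * ℓ.Z) c : Finset Γ)).ncard
        ≤ B * ∑ z ∈ ℓ.Z, ((H : Set Γ) ∩ (rightTranslate ℓ.F (z * c) : Finset Γ)).ncard :=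
          Nat.mul_le_mul_left _ ((Set.ncard_le_ncard hsub hfin).trans
            (Finset.set_ncard_biUnion_le _ _))
      _ = ∑ z ∈ ℓ.Z, B * ((H : Set Γ) ∩ (rightTranslate ℓ.F (z * c) : Finset Γ)).ncard :=
          Finset.mul_sum _ _ _
      _ ≤ ∑ _z ∈ ℓ.Z, ℓ.F.card := Finset.sum_le_sum fun z _ => h _
      _ = (ℓ.F * ℓ.Z).card := by
          rw [Finset.sum_const, smul_eq_mul, card_shape_true, mul_comm]

end Level

variable {ℓ : ℕ → Level H} {D J : ℕ → Finset Γ} {c : ℕ → Γ}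

/-- The substitution of a sequence of successive refinements. -/
def refinementSubstitution (href : ∀ n, (ℓ n).Refines (ℓ (n + 1)) (D n) (J n) (c n))
    (hex : ∀ g, ∃ n, g ∈ (ℓ n).F * (ℓ n).Z) : Substitution Γ where
  shape n := (ℓ n).shape
  -- The single special tile placed in each regular shape is what makes the special centers
  -- syndetic.
  rule n b := match b with
    | true => (ℓ n).rule (D n * (ℓ (n + 1)).Z) (J n)
    | false => (ℓ n).rule (D n) {c n}
  rule_subset := by
    rintro n (_ | _)
    · change ∀ q ∈ _, _ ⊆ (ℓ (n + 1)).F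
      rw [(href n).F_eq]
      exact (ℓ n).rule_subset (href n).Zc_subset
    · change ∀ q ∈ _, _ ⊆ (ℓ (n + 1)).F * (ℓ (n + 1)).Z
      rw [(href n).F_eq, mul_assoc]
      exact (ℓ n).rule_subset (href n).ZJ_subset
  rule_unique := by
    rintro n (_ | _)
    · change ∀ s ∈ (ℓ (n + 1)).F, _
      rw [(href n).F_eq]
      exact (ℓ n).rule_unique (href n).Zc_subset (href n).D_subset fun j hj j' hj' => by
        rw [Finset.mem_singleton.1 hj, Finset.mem_singleton.1 hj', mul_inv_cancel]
        exact one_mem H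
    · change ∀ s ∈ (ℓ (n + 1)).F * (ℓ (n + 1)).Z, _
      rw [(href n).F_eq, mul_assoc]
      refine (ℓ n).rule_unique (href n).ZJ_subset (fun w hw => ?_) fun j hj j' hj' =>
        H.mul_mem ((href n).J_subset j hj).1 (H.inv_mem ((href n).J_subset j' hj').1)
      obtain ⟨d, hd, z, hz, rfl⟩ := Finset.mem_mul.1 hw
      exact (ℓ n).N.mul_mem ((href n).D_subset d hd)
        ((href n).le ((ℓ (n + 1)).Z_subset z hz))
  one_mem_shape n := (ℓ n).one_mem_shape
  one_mem_rule n := Level.mem_rule.2 (Or.inl ⟨1, (href n).one_mem_J, rfl⟩)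
  rule_occurs := by
    rintro n (_ | _) (_ | _)
    · obtain ⟨x, hx, hx'⟩ := (href n).exists_notMem_Zc
      exact ⟨x, Level.mem_rule.2 (Or.inr ⟨x, Finset.mem_sdiff.2 ⟨hx, hx'⟩, rfl⟩)⟩
    · exact ⟨c n, Level.mem_rule.2 (Or.inl ⟨c n, Finset.mem_singleton_self _, rfl⟩)⟩
    · obtain ⟨x, hx, hx'⟩ := (href n).exists_notMem_ZJ
      exact ⟨x, Level.mem_rule.2 (Or.inr ⟨x, Finset.mem_sdiff.2 ⟨hx, hx'⟩, rfl⟩)⟩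
    · exact ⟨1, Level.mem_rule.2 (Or.inl ⟨1, (href n).one_mem_J, rfl⟩)⟩
  exhausts := hex

variable (href : ∀ n, (ℓ n).Refines (ℓ (n + 1)) (D n) (J n) (c n))
  (hex : ∀ g, ∃ n, g ∈ (ℓ n).F * (ℓ n).Z)

theorem mem_of_mem_level {n : ℕ} {p : Bool × Γ}
    (hp : p ∈ (refinementSubstitution href hex).level n) : p.2 ∈ (ℓ n).N := by
  obtain ⟨k, hk⟩ := Set.mem_iUnion.1 hp
  induction k generalizing n p with
  | zero =>
    rw [Set.mem_singleton_iff.1 hk]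
    exact one_mem _
  | succ k ih =>
    obtain ⟨q, hq, r, hr, rfl⟩ := hk
    refine (ℓ n).N.mul_mem ?_ ((href n).le (ih (Set.mem_iUnion.2 ⟨k, hq⟩) hq))
    obtain ⟨_ | _, x⟩ := q
    · rcases Level.mem_rule.1 hr with ⟨j, hj, rfl⟩ | ⟨y, hy, rfl⟩
      · rw [Finset.mem_singleton.1 hj]
        exact (href n).c_mem
      · exact (href n).D_subset y (Finset.mem_sdiff.1 hy).1
    · rcases Level.mem_rule.1 hr with ⟨j, hj, rfl⟩ | ⟨y, hy, rfl⟩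
      · exact ((href n).J_subset j hj).2
      · obtain ⟨d, hd, z, hz, rfl⟩ := Finset.mem_mul.1 (Finset.mem_sdiff.1 hy).1
        exact (ℓ n).N.mul_mem ((href n).D_subset d hd)
          ((href n).le ((ℓ (n + 1)).Z_subset z hz))

/-- Digit expansion: an element of `J` is split off at each level, and the product of the digits is
a special center. -/
theorem exists_mem_pieces (k : ℕ) {n : ℕ} {h : Γ} (hh : h ∈ H ⊓ (ℓ n).N) :
    ∃ p, ∃ h' ∈ H ⊓ (ℓ (n + k)).N,
      (true, p) ∈ (refinementSubstitution href hex).pieces k n ∧ h = p * h' := by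
  induction k generalizing n h with
  | zero => exact ⟨1, h, hh, rfl, (one_mul h).symm⟩
  | succ k ih =>
    obtain ⟨j, hj, hjh⟩ := (href n).exists_mem_J h hh
    obtain ⟨p, h', hh', hp, heq⟩ := ih (n := n + 1)
      (h := j⁻¹ * h) ⟨H.mul_mem (H.inv_mem ((href n).J_subset j hj).1) hh.1, hjh⟩
    refine ⟨j * p, h', ?_, ⟨(true, p), hp, (true, j), ?_, rfl⟩, ?_⟩
    · rwa [show n + (k + 1) = n + 1 + k by omega]
    · exact Level.mem_rule.2 (Or.inl ⟨j, hj, rfl⟩)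
    · rw [mul_assoc, ← heq, mul_inv_cancel_left]

/-- Expand `h = p h'` up to a level whose special shape contains `h`. That shape also contains `p`,
so the `Z`-components of `p` and `h` differ by `h' ∈ H`. Injectivity of `Z` modulo `H` gives `h' =
1`, and `h = p` is a special center. -/
theorem mem_level_of_mem {n : ℕ} {h : Γ} (hh : h ∈ H ⊓ (ℓ n).N) :
    (true, h) ∈ (refinementSubstitution href hex).level n := by
  set σ := refinementSubstitution href hex with hσ
  obtain ⟨m, hm⟩ := σ.exhausts h
  obtain ⟨p, h', hh', hp, rfl⟩ := exists_mem_pieces href hex m hh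
  have h1 : p * h' ∈ (ℓ (n + m)).F * (ℓ (n + m)).Z := σ.shape_mono (Nat.le_add_left m n) hm
  have h2 : p ∈ (ℓ (n + m)).F * (ℓ (n + m)).Z := by
    refine σ.tile_subset_of_mem_pieces hp (mem_rightTranslate.2 ?_)
    rw [mul_inv_cancel]
    exact σ.one_mem_shape n true
  obtain ⟨f, hf, z, hz, rfl⟩ := Finset.mem_mul.1 h2
  obtain ⟨f', hf', z', hz', heq⟩ := Finset.mem_mul.1 h1
  rw [mul_assoc] at heq
  obtain ⟨-, hzz⟩ := (ℓ (n + m)).eq_and_eq_of_mul_eq hf' hf ((ℓ (n + m)).Z_subset z' hz')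
    ((ℓ (n + m)).N.mul_mem ((ℓ (n + m)).Z_subset z hz) hh'.2) heq
  have hz1 := (ℓ (n + m)).Z_inj z hz z' hz' (by rw [hzz, inv_mul_cancel_left]; exact hh'.1)
  have h'1 : h' = 1 := by
    rw [← hz1] at hzz
    exact (mul_eq_left.1 hzz.symm)
  rw [h'1, mul_one]
  exact Set.mem_iUnion.2 ⟨m, hp⟩

theorem realizesPropertyID (hcyc : IsCyclic H) (hinf : Infinite H) (hidx : ¬ H.FiniteIndex)
    (hinv : ∀ (E : Finset Γ) (ε : ℝ), 0 < ε → ∃ N, ∀ n ≥ N, IsInvariant E ε (ℓ n).F)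
    (hcard : ∀ n, n ≤ (ℓ n).F.card)
    (hthin : ∀ n g, n * ((H : Set Γ) ∩ (rightTranslate (ℓ n).F g : Finset Γ)).ncard ≤
      (ℓ n).F.card) :
    RealizesPropertyID H (refinementSubstitution href hex).tiling := by
  set σ := refinementSubstitution href hex with hσ
  have hΓinf : Infinite Γ := Infinite.of_injective _ (Subtype.val_injective (p := (· ∈ H)))
  refine ⟨hcyc, hinf, hidx, σ.isTightlyNested, ?_, ?_, ?_, σ.finset_subset_tile, ?_, ?_⟩
  · intro E ε hε
    obtain ⟨N, hN⟩ := hinv E ε hε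
    refine ⟨N, fun n hn S hS => ?_⟩
    obtain ⟨b, rfl⟩ := σ.isShape_iff.1 hS
    exact (ℓ n).isInvariant_shape (hN n hn) b
  · intro n p hp
    obtain ⟨b, rfl⟩ := σ.mem_pairs.1 hp
    exact σ.isSyndetic_centers n b
  · intro F hF
    have hlim : Tendsto (fun n : ℕ => ((2 * Real.log 3 / n : ℝ) : EReal)) atTop (𝓝 0) := by
      have h := tendsto_const_div_atTop_nhds_zero_nat (2 * Real.log 3)
      exact (continuous_coe_real_ereal.tendsto 0).comp h
    refine tendsto_of_tendsto_of_tendsto_of_le_of_le' tendsto_const_nhds hlim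
      (Eventually.of_forall fun n => topEntropy_nonneg F) ?_
    filter_upwards [eventually_ge_atTop 1] with n hn
    have hNn := (ℓ n).normal
    have hNf := (ℓ n).finiteIndex
    refine (σ.entropy_le n (ℓ n).N (fun p hp => mem_of_mem_level href hex hp)
      ⟨1, (ℓ n).one_mem_F⟩ (ℓ n).F_inj hF).trans (EReal.coe_le_coe_iff.2 ?_)
    have hn' : (0 : ℝ) < n := by exact_mod_cast hn
    have hc : (n : ℝ) ≤ (ℓ n).F.card := by exact_mod_cast hcard n
    gcongr
  · intro δ hδ
    obtain ⟨N, hN⟩ := exists_nat_gt (1 / δ)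
    refine ⟨N, fun n hn T hT => ?_⟩
    obtain ⟨S, x, hSx, rfl⟩ := hT
    obtain ⟨b, rfl, -⟩ := σ.isCenter_iff.1 hSx
    have h := (ℓ n).mul_ncard_inter_shape_le (hthin n) b x
    have hn' : 1 / δ ≤ n := hN.le.trans (by exact_mod_cast hn)
    rw [div_le_iff₀ hδ] at hn'
    have hc : (rightTranslate (σ.shape n b) x).card = ((ℓ n).shape b).card := Finset.card_map _
    rw [hc]
    have h' : (n : ℝ) * ((H : Set Γ) ∩ (rightTranslate ((ℓ n).shape b) x : Finset Γ)).ncard ≤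
        ((ℓ n).shape b).card := by exact_mod_cast h
    change (((H : Set Γ) ∩ (rightTranslate ((ℓ n).shape b) x : Finset Γ)).ncard : ℝ) ≤ _
    nlinarith [mul_le_mul_of_nonneg_left h' hδ.le, mul_le_mul_of_nonneg_right hn'
      (Nat.cast_nonneg (α := ℝ)
        ((H : Set Γ) ∩ (rightTranslate ((ℓ n).shape b) x : Finset Γ)).ncard)]
  · intro n
    refine ⟨σ.shape n true, H ⊓ (ℓ n).N, inf_le_left, σ.isShape_iff.2 ⟨true, rfl⟩,
      fun x hx => σ.isCenter_iff.2 ⟨true, rfl, mem_level_of_mem href hex hx⟩, fun h hh => ?_⟩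
    obtain ⟨f, hf, z, hz, l, hl, rfl⟩ := (ℓ n).covers h hh
    exact ⟨l, hl, mul_mem_rightTranslate (S := (ℓ n).F * (ℓ n).Z) (Finset.mul_mem_mul hf hz)⟩

end Assembly

end PropID

/-! ### The theorem, by iterated refinement -/

theorem mainTheorem12 {Γ : Type*} [Group Γ] [Countable Γ] [Group.ResiduallyFinite Γ]
    (hΓ : PropID.IsAmenable Γ)
    (ha : ∃ a : Γ, ¬ IsOfFinOrder a ∧ (conjugatesOf a).Infinite) :
    PropID.HasPropertyID Γ := by
  classical
  obtain ⟨a, ha, hconj⟩ := ha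
  obtain ⟨e, he⟩ := exists_surjective_nat Γ
  let E : ℕ → Finset Γ := fun n => (Finset.range (n + 1)).image e
  have hEmono : ∀ {m n : ℕ}, m ≤ n → e m ∈ E n := fun h =>
    Finset.mem_image_of_mem e (Finset.mem_range.2 (Nat.lt_succ_of_le h))
  have hstep : ∀ (n : ℕ) (ℓ : PropID.Level (Subgroup.zpowers a)), _ := fun n ℓ =>
    PropID.Level.exists_refines hΓ hconj rfl ℓ (E n) (E n) (ε := 1 / (n + 1)) (by positivity)
      (n + 1)
  choose next D J c href hK hinv hcard hthin using hstep
  let ℓ : ℕ → PropID.Level (Subgroup.zpowers a) := fun n =>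
    Nat.rec (PropID.Level.top _) (fun n ℓ => next n ℓ) n
  refine ⟨Subgroup.zpowers a, _, PropID.realizesPropertyID (ℓ := ℓ) (D := fun n => D n (ℓ n))
    (J := fun n => J n (ℓ n)) (c := fun n => c n (ℓ n)) (fun n => href n (ℓ n)) ?_ inferInstance
    (Set.infinite_coe_iff.2 (infinite_zpowers.2 ha)) (PropID.not_finiteIndex_zpowers hconj)
    ?_ ?_ ?_⟩
  · intro g
    obtain ⟨n, rfl⟩ := he g
    exact ⟨n + 1, hK n (ℓ n) (hEmono le_rfl)⟩
  · intro K ε hε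
    choose m hm using he
    obtain ⟨M, hM⟩ := exists_nat_gt (1 / ε)
    refine ⟨max (K.sup m) M + 1, fun n hn => ?_⟩
    obtain ⟨n, rfl⟩ := Nat.exists_eq_add_of_le' (Nat.one_le_of_lt hn)
    have hn' := Nat.le_of_succ_le_succ hn
    refine (hinv n (ℓ n)).mono (fun g hg => ?_) ?_
    · rw [← hm g]
      exact hEmono ((Finset.le_sup hg).trans ((le_max_left _ _).trans hn'))
    · have h1 : (M : ℝ) ≤ n := by exact_mod_cast (le_max_right _ _).trans hn'
      rw [div_le_iff₀ (by positivity)]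
      rw [div_lt_iff₀ hε] at hM
      nlinarith
  -- Level 0 is the whole group, where the bound is trivial; level `n + 1` was built with `B = n +
  -- 1`.
  · rintro (_ | n)
    · exact Nat.zero_le _
    · exact hcard n (ℓ n)
  · rintro (_ | n) g
    · simp
    · exact hthin n (ℓ n) g
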